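/- Let $d\ge 1$ and let $H_\omega=-\Delta+V_\omega$ on $\ell^2(\mathbb Z^d)$, where $\Delta$ is the nearest-neighbour difference operator (discrete Laplacian) and the site potentials $V_\omega(x)$, $x\in\mathbb Z^d$, are independent identically distributed real random variables whose distribution has a bounded density with compact support. For $L>0$ let $\Lambda_L=[-L,L]^d\cap\mathbb Z^d$, and let $H_{\Lambda_L;\omega}$ be the restriction of $H_\omega$ to $\Lambda_L$ (the matrix $\langle x|H_\omega|y\rangle$, $x,y\in\Lambda_L$). Let $\beta\in(0,1)$ and $\xi>3(d-1)$. Then there are $s\in(0,1)$ and, for each $L>0$, numbers $\delta_L>0$ and $P_L>0$ with the following property: if for some $L>0$ and some $E\in\mathbb R$ $$\operatorname{Prob}\left[\operatorname{dist}\left(\sigma(H_{\Lambda_L;\omega}),E\right)\le\delta_L\right]<P_L ,$$ then exponential fractional-moment localization holds on some open interval $(a,b)$ containing $E$, that is, there are $A<\infty$ and $\mu>0$ such that $$\mathbb E\left(\left|\langle x|\,(H_\omega-E'-\mathrm i\eta)^{-1}\,|y\rangle\right|^s\right)\le A\,e^{-\mu|x-y|}$$ for all $x,y\in\mathbb Z^d$,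 all $E'\in(a,b)$ and all real $\eta\ne0$. Moreover $\delta_L$ and $P_L$ satisfy $$0<\liminf_{L\to\infty}L^\beta\delta_L,\qquad \limsup_{L\to\infty}L^\beta\delta_L<\infty,\qquad \liminf_{L\to\infty}L^\xi P_L>0 .$$ -/

import Mathlib

open Filter MeasureTheory ProbabilityTheory
open scoped NNReal ENNReal Topology

noncomputable section

namespace RandomSchrodinger

/-- The lattice `ℤ^d`. -/
abbrev Site (d : ℕ) : Type := Fin d → ℤ

/-- The Hilbert space `ℓ²(ℤ^d)` of complex square summable functions. -/
abbrev L2 (d : ℕ) : Type := lp (fun _ : Site d => ℂ) 2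

/-- The lattice distance `|x - y| = ∑ᵢ |xᵢ - yᵢ|`. -/
def siteDist {d : ℕ} (x y : Site d) : ℝ := ∑ i, |((x i - y i : ℤ) : ℝ)|

/-- Two sites are nearest neighbours if their lattice distance is one. -/
def Neighbors {d : ℕ} (x y : Site d) : Prop := ∑ i, |x i - y i| = 1

instance {d : ℕ} (x y : Site d) : Decidable (Neighbors x y) :=
  inferInstanceAs (Decidable (_ = _))

theorem memlp_shift {d : ℕ} (v : Site d) (ψ : L2 d) :
    Memℓp (fun x => (ψ : Site d → ℂ) (x + v)) 2 := by
  have h2 : 0 < (2 : ℝ≥0∞).toReal := by norm_num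
  refine memℓp_gen ?_
  exact ((lp.memℓp ψ).summable h2).comp_injective (add_left_injective v)

/-- The translation operator `(T_v ψ)(x) = ψ(x + v)` on `ℓ²(ℤ^d)`. -/
def shift {d : ℕ} (v : Site d) : L2 d →L[ℂ] L2 d :=
  LinearMap.mkContinuous
    { toFun := fun ψ => ⟨fun x => (ψ : Site d → ℂ) (x + v), memlp_shift v ψ⟩
      map_add' := fun _ _ => rfl
      map_smul' := fun _ _ => rfl } 1 (by
    intro ψ
    have h2 : 0 < (2 : ℝ≥0∞).toReal := by norm_num
    rw [one_mul]
    refine lp.norm_le_of_tsum_le h2 (norm_nonneg _) ?_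
    rw [lp.norm_rpow_eq_tsum h2 ψ]
    exact le_of_eq ((Equiv.addRight v).tsum_eq
      (fun x => ‖(ψ : Site d → ℂ) x‖ ^ (2 : ℝ≥0∞).toReal)))

@[simp] theorem shift_apply {d : ℕ} (v : Site d) (ψ : L2 d) (x : Site d) :
    (shift v ψ : Site d → ℂ) x = (ψ : Site d → ℂ) (x + v) := rfl

/-- The nearest neighbour difference operator (discrete Laplacian) on `ℓ²(ℤ^d)`. -/
def laplacian (d : ℕ) : L2 d →L[ℂ] L2 d :=
  ∑ i : Fin d, (shift (Pi.single i 1) + shift (-Pi.single i 1) - (2 : ℂ) • 1)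

open Classical in
/-- Multiplication by a bounded potential `V` on `ℓ²(ℤ^d)`. For an unbounded `V` the value is `0`,
by convention; the random potentials considered below are almost surely bounded. -/
def mulOp {d : ℕ} (V : Site d → ℝ) : L2 d →L[ℂ] L2 d :=
  if h : BddAbove (Set.range fun x => |V x|) then
    lp.mapCLM (E := fun _ : Site d => ℂ) (F := fun _ : Site d => ℂ) 2
      (fun x => ((V x : ℂ)) • ContinuousLinearMap.id ℂ ℂ)
      (K := ⨆ x, |V x|) (Real.iSup_nonneg fun _ => abs_nonneg _)
      (fun x => by
        rw [norm_smul, ContinuousLinearMap.norm_id, mul_one, Complex.norm_real, Real.norm_eq_abs]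
        exact le_ciSup h x)
  else 0

theorem mulOp_apply {d : ℕ} {V : Site d → ℝ} (h : BddAbove (Set.range fun x => |V x|))
    (ψ : L2 d) (x : Site d) :
    (mulOp V ψ : Site d → ℂ) x = (V x : ℂ) * (ψ : Site d → ℂ) x := by
  rw [mulOp, dif_pos h]
  rfl

/-- The discrete Schrödinger operator `H = -Δ + V` on `ℓ²(ℤ^d)`. -/
def hamiltonian {d : ℕ} (V : Site d → ℝ) : L2 d →L[ℂ] L2 d :=
  -laplacian d + mulOp V

/-- The site vector `|x⟩`. -/
def ket {d : ℕ} (x : Site d) : L2 d := lp.single 2 x (1 : ℂ)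

/-- The Green function `G(x, y; z) = ⟨x| (H - z)⁻¹ |y⟩`. -/
def green {d : ℕ} (V : Site d → ℝ) (z : ℂ) (x y : Site d) : ℂ :=
  inner ℂ (ket x) (Ring.inverse (hamiltonian V - z • (1 : L2 d →L[ℂ] L2 d)) (ket y))

/-- The box `Λ_L = [-L, L]^d ∩ ℤ^d`. -/
def box (d : ℕ) (L : ℝ) : Finset (Site d) :=
  Finset.Icc (fun _ => -⌊L⌋) (fun _ => ⌊L⌋)

theorem mem_box {d : ℕ} {L : ℝ} {x : Site d} : x ∈ box d L ↔ ∀ i, |(x i : ℝ)| ≤ L := by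
  simp only [box, Finset.mem_Icc, Pi.le_def, abs_le, ← forall_and]
  refine forall_congr' fun i => ?_
  rw [Int.le_floor, neg_le, Int.le_floor, Int.cast_neg, neg_le]

/-- The restriction `H_Λ` of `H = -Δ + V` to a finite region `Λ`, that is the matrix
`⟨x| H |y⟩` with `x, y ∈ Λ`. -/
def finiteHamiltonian {d : ℕ} (V : Site d → ℝ) (Λ : Finset (Site d)) : Matrix Λ Λ ℝ :=
  Matrix.of fun x y =>
    if x = y then 2 * (d : ℝ) + V x else if Neighbors (x : Site d) (y : Site d) then -1 else 0

/-- A regular random potential: the values `V x` are independent and identically distributed,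
their common distribution having a bounded density with compact support. -/
structure IsRegular {d : ℕ} {Ω : Type*} [MeasurableSpace Ω] (μ : Measure Ω)
    (V : Site d → Ω → ℝ) : Prop where
  measurable : ∀ x, Measurable (V x)
  indep : iIndepFun V μ
  density : ∃ ρ : ℝ → ℝ≥0, Measurable ρ ∧ (∃ M : ℝ≥0, ∀ v, ρ v ≤ M) ∧ HasCompactSupport ρ ∧
    ∀ x, μ.map (V x) = volume.withDensity fun v => (ρ v : ℝ≥0∞)

/-- Exponential decay of the `s`-moments of the Green function, uniformly in `η` and in the
energies `E ∈ (a, b)`: there are `A < ∞` and `m > 0` such that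
`𝔼 |G(x, y; E + iη)|^s ≤ A e^{- m |x - y|}`. -/
def FractionalMomentLocalization {d : ℕ} {Ω : Type*} [MeasurableSpace Ω] (μ : Measure Ω)
    (V : Site d → Ω → ℝ) (s a b : ℝ) : Prop :=
  ∃ A m : ℝ, 0 < m ∧ ∀ E ∈ Set.Ioo a b, ∀ η : ℝ, η ≠ 0 → ∀ x y : Site d,
    ∫⁻ ω, ENNReal.ofReal (‖green (fun u => V u ω) (E + η * Complex.I) x y‖ ^ s) ∂μ
      ≤ ENNReal.ofReal (A * Real.exp (-m * siteDist x y))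

end RandomSchrodinger

end

/-! Write G for the Green function and decouple a box Λ around 0 from its complement. For y outside
Λ, two uses of the resolvent identity expand G(0, y) in products of three factors, summed over
boundary edges e, e': a decoupled Green function from 0 to the inner end of e', a full one from the
outer end of e' to the inner end of e, and a decoupled one from the outer end of e to y. There is
also a term without the middle factor.

The first factor is small unless the spectrum of the box comes within δ of the energy: the
Combes–Thomas estimate bounds it by (4/δ) exp(-cδL). The other factors need not be small, but Green
functions have bounded fractional moments. This holds uniformly in z and conditionally on the
potential off any set containing the two sites. It comes from Krein's formula for the rank-two
perturbation at those sites (`two_site_bound`, `exists_lintegral_entry_rpow_le`).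

The last factor is correlated with the others. The potential on Λ and its outer neighbours is
therefore replaced by an independent copy W, while V denotes the original potential. Comparing the
decoupled operator carrying the mixed potential with the full operator carrying V writes the last
factor through W-dependent decoupled Green functions near the boundary and Green functions of V
ending at y (`enorm_entry_decOp_rpow_le`); this costs a third boundary sum. Given V, at most three
W-dependent factors remain. Hölder's inequality treats each as the 2s-th power of a half moment and
leaves the probability P of resonance with exponent 1 - 6s. Integrating over V gives
(`lintegral_entry_fullOp_le`), up to constants, E|G(0, y)|^s ≤ |∂Λ|³ ((e^{-cδL}/δ)^s + P^{1-6s})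
sup_w E|G(w, y)|^s, with w near Λ.

Since |∂Λ| is of order L^{d-1}, the choices δ = L^{-β} and P = L^{-ξ} with ξ > 3(d-1) make the
prefactor at most 1/2 for s small and L large. Stationarity and iteration turn this into exponential
decay (`lintegral_entry_le_exp`). Small L are harmless: there δ_L is so large that only energies far
from every spectrum satisfy the hypothesis. -/

noncomputable section

namespace RandomSchrodinger

variable {d : ℕ}

/-! ### Site vectors and self-adjointness -/

theorem inner_ket (x : Site d) (ψ : L2 d) : inner ℂ (ket x) ψ = (ψ : Site d → ℂ) x := by
  rw [ket, lp.inner_single_left]; simp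

theorem ket_apply (x y : Site d) : (ket x : Site d → ℂ) y = if y = x then 1 else 0 := by
  rw [ket, lp.single_apply]
  by_cases h : y = x
  · subst h; simp
  · simp [h]

theorem norm_apply_le (ψ : L2 d) (x : Site d) : ‖(ψ : Site d → ℂ) x‖ ≤ ‖ψ‖ :=
  lp.norm_apply_le_norm (by norm_num) ψ x

/-- The operator `|x⟩⟨y|`. -/
def ketbra (x y : Site d) : L2 d →L[ℂ] L2 d := InnerProductSpace.rankOne ℂ (ket x) (ket y)

theorem ketbra_apply (x y : Site d) (ψ : L2 d) :
    ketbra x y ψ = (ψ : Site d → ℂ) y • ket x := by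
  rw [ketbra, InnerProductSpace.rankOne_apply, inner_ket]

theorem isSelfAdjoint_mulOp (V : Site d → ℝ) : IsSelfAdjoint (mulOp V) := by
  by_cases h : BddAbove (Set.range fun x => |V x|)
  · rw [ContinuousLinearMap.isSelfAdjoint_iff_isSymmetric]
    intro φ ψ
    simp only [ContinuousLinearMap.coe_coe]
    rw [lp.inner_eq_tsum, lp.inner_eq_tsum]
    refine tsum_congr fun x => ?_
    simp only [mulOp_apply h]
    simp; ring
  · rw [mulOp, dif_neg h]; exact IsSelfAdjoint.zero _

theorem inner_shift (v : Site d) (φ ψ : L2 d) :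
    inner ℂ (shift v φ) ψ = inner ℂ φ (shift (-v) ψ) := by
  rw [lp.inner_eq_tsum, lp.inner_eq_tsum, ← (Equiv.addRight v).tsum_eq
    (fun x => inner ℂ ((φ : Site d → ℂ) x) ((shift (-v) ψ : Site d → ℂ) x))]
  refine tsum_congr fun x => ?_
  simp

theorem isSelfAdjoint_laplacian : IsSelfAdjoint (laplacian d) := by
  rw [ContinuousLinearMap.isSelfAdjoint_iff_isSymmetric]
  intro φ ψ
  simp only [ContinuousLinearMap.coe_coe, laplacian, sum_apply, sum_inner,
    inner_sum]
  refine Finset.sum_congr rfl fun i _ => ?_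
  simp only [sub_apply, add_apply, inner_sub_left,
    inner_add_left, inner_shift, inner_sub_right, inner_add_right, neg_neg,
    smul_apply, one_apply_eq_self, inner_smul_left,
    inner_smul_right]
  simp only [map_ofNat]
  ring

/-! ### Resolvents, their matrix elements and symmetry -/

/-- The resolvent `(A - z)⁻¹`. -/
def res (A : L2 d →L[ℂ] L2 d) (z : ℂ) : L2 d →L[ℂ] L2 d := Ring.inverse (A - z • 1)

theorem isUnit_sub_smul {A : L2 d →L[ℂ] L2 d} (hA : IsSelfAdjoint A) {z : ℂ} (hz : z.im ≠ 0) :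
    IsUnit (A - z • (1 : L2 d →L[ℂ] L2 d)) := by
  by_contra h
  apply hz
  apply hA.im_eq_zero_of_mem_spectrum
  rw [spectrum.mem_iff, ← IsUnit.sub_iff]
  rwa [Algebra.algebraMap_eq_smul_one]

theorem res_mul {A : L2 d →L[ℂ] L2 d} (hA : IsSelfAdjoint A) {z : ℂ} (hz : z.im ≠ 0) :
    res A z * (A - z • 1) = 1 := Ring.inverse_mul_cancel _ (isUnit_sub_smul hA hz)

theorem mul_res {A : L2 d →L[ℂ] L2 d} (hA : IsSelfAdjoint A) {z : ℂ} (hz : z.im ≠ 0) :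
    (A - z • 1) * res A z = 1 := Ring.mul_inverse_cancel _ (isUnit_sub_smul hA hz)

theorem res_sub_res {A B : L2 d →L[ℂ] L2 d} (hA : IsSelfAdjoint A) (hB : IsSelfAdjoint B) {z : ℂ}
    (hz : z.im ≠ 0) : res A z - res B z = res A z * (B - A) * res B z := by
  have : B - A = (B - z • 1) - (A - z • 1) := by abel
  rw [this, mul_sub, sub_mul, mul_assoc, mul_res hB hz, res_mul hA hz, mul_one, one_mul]

theorem abs_im_mul_norm_le {A : L2 d →L[ℂ] L2 d} (hA : IsSelfAdjoint A) (z : ℂ) (ψ : L2 d) :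
    |z.im| * ‖ψ‖ ≤ ‖(A - z • (1 : L2 d →L[ℂ] L2 d)) ψ‖ := by
  rcases eq_or_ne ψ 0 with rfl | hψ
  · simp
  have hpos : 0 < ‖ψ‖ := norm_pos_iff.2 hψ
  have him : (inner ℂ ψ (A ψ)).im = 0 := by
    have := (ContinuousLinearMap.isSelfAdjoint_iff_isSymmetric.1 hA).im_inner_self_apply ψ
    simpa using this
  have h1 : (inner ℂ ψ ((A - z • (1 : L2 d →L[ℂ] L2 d)) ψ)).im = -(z.im * ‖ψ‖ ^ 2) := by
    simp only [sub_apply, smul_apply,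
      one_apply_eq_self, inner_sub_right, inner_smul_right, Complex.sub_im, him]
    rw [inner_self_eq_norm_sq_to_K, Complex.mul_im]
    have h2 : (((‖ψ‖ : ℝ) : ℂ) ^ 2).im = 0 := by rw [← Complex.ofReal_pow, Complex.ofReal_im]
    have h3 : (((‖ψ‖ : ℝ) : ℂ) ^ 2).re = ‖ψ‖ ^ 2 := by rw [← Complex.ofReal_pow, Complex.ofReal_re]
    simp only [Complex.coe_algebraMap, h2, h3]
    ring
  have h2 := (Complex.abs_im_le_norm _).trans
    (norm_inner_le_norm (𝕜 := ℂ) ψ ((A - z • (1 : L2 d →L[ℂ] L2 d)) ψ))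
  rw [h1, abs_neg, abs_mul, abs_of_nonneg (sq_nonneg ‖ψ‖)] at h2
  nlinarith

theorem norm_res_apply_le {A : L2 d →L[ℂ] L2 d} (hA : IsSelfAdjoint A) {z : ℂ} (hz : z.im ≠ 0)
    (ψ : L2 d) : ‖res A z ψ‖ ≤ |z.im|⁻¹ * ‖ψ‖ := by
  have h := abs_im_mul_norm_le hA z (res A z ψ)
  rw [← mul_apply_eq_comp, mul_res hA hz, one_apply_eq_self] at h
  have hp : 0 < |z.im| := abs_pos.2 hz
  rwa [inv_mul_eq_div, le_div_iff₀ hp, mul_comm]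

/-- The matrix element `⟨x| (A - z)⁻¹ |y⟩`. -/
def entry (A : L2 d →L[ℂ] L2 d) (z : ℂ) (x y : Site d) : ℂ := (res A z (ket y) : Site d → ℂ) x

theorem green_eq_entry (V : Site d → ℝ) (z : ℂ) (x y : Site d) :
    green V z x y = entry (-laplacian d + mulOp V) z x y := by
  rw [green, inner_ket]; rfl

theorem res_adjoint {A : L2 d →L[ℂ] L2 d} (hA : IsSelfAdjoint A) (z : ℂ) :
    star (res A z) = res A (star z) := by
  rw [res, res, ← Ring.inverse_star, star_sub, hA.star_eq, star_smul, star_one]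

theorem entry_conj {A : L2 d →L[ℂ] L2 d} (hA : IsSelfAdjoint A) (z : ℂ) (x y : Site d) :
    entry A z x y = star (entry A (star z) y x) := by
  rw [entry, entry, ← inner_ket, ← inner_ket, ← res_adjoint hA, ContinuousLinearMap.star_eq_adjoint,
    ContinuousLinearMap.adjoint_inner_right]
  exact (inner_conj_symm _ _).symm

/-- An operator is real if it commutes with complex conjugation. -/
def IsRealOp (A : L2 d →L[ℂ] L2 d) : Prop := ∀ ψ : L2 d, A (star ψ) = star (A ψ)

theorem star_ket (x : Site d) : star (ket x : L2 d) = ket x := by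
  ext y
  rw [lp.star_apply, ket_apply]
  split_ifs <;> simp

theorem res_star {A : L2 d →L[ℂ] L2 d} (hA : IsSelfAdjoint A) (hR : IsRealOp A) {z : ℂ}
    (hz : z.im ≠ 0) (ψ : L2 d) : star (res A z ψ) = res A (star z) (star ψ) := by
  have hz' : (star z).im ≠ 0 := by simpa using hz
  have h : (A - star z • (1 : L2 d →L[ℂ] L2 d)) (star (res A z ψ)) = star ψ := by
    have h1 : (A - z • (1 : L2 d →L[ℂ] L2 d)) (res A z ψ) = ψ := by
      rw [← mul_apply_eq_comp, mul_res hA hz]; rfl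
    conv_rhs => rw [← h1]
    simp [hR _, star_sub, star_smul]
  rw [← h, ← mul_apply_eq_comp, res_mul hA hz']; rfl

/-- Self-adjointness exchanges the sites at the price of conjugating both z and the value; reality
undoes both conjugations. The symmetry lets a single number `b` stand for both off-diagonal elements
in Krein's formula. -/
theorem entry_symm {A : L2 d →L[ℂ] L2 d} (hA : IsSelfAdjoint A) (hR : IsRealOp A) {z : ℂ}
    (hz : z.im ≠ 0) (x y : Site d) : entry A z x y = entry A z y x := by
  rw [entry_conj hA, entry, entry]
  have := res_star hA hR hz (ket x)
  rw [star_ket] at this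
  rw [← this, lp.star_apply, star_star]

theorem isRealOp_mulOp (V : Site d → ℝ) : IsRealOp (mulOp V) := by
  intro ψ
  by_cases h : BddAbove (Set.range fun x => |V x|)
  · ext x
    rw [mulOp_apply h, lp.star_apply, lp.star_apply, mulOp_apply h]
    simp
  · rw [mulOp, dif_neg h]; simp

theorem IsRealOp.add {A B : L2 d →L[ℂ] L2 d} (hA : IsRealOp A) (hB : IsRealOp B) :
    IsRealOp (A + B) := fun ψ => by simp [hA ψ, hB ψ]

theorem IsRealOp.sub {A B : L2 d →L[ℂ] L2 d} (hA : IsRealOp A) (hB : IsRealOp B) :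
    IsRealOp (A - B) := fun ψ => by simp [hA ψ, hB ψ]

theorem IsRealOp.mul {A B : L2 d →L[ℂ] L2 d} (hA : IsRealOp A) (hB : IsRealOp B) :
    IsRealOp (A * B) := fun ψ => by simp [hA _, hB ψ]

theorem isRealOp_one : IsRealOp (1 : L2 d →L[ℂ] L2 d) := fun ψ => by simp

theorem isRealOp_shift (v : Site d) : IsRealOp (shift v : L2 d →L[ℂ] L2 d) := by
  intro ψ
  ext x
  simp

theorem isRealOp_neg_laplacian : IsRealOp (-laplacian d) := by
  intro ψ
  simp only [neg_apply, laplacian, sum_apply, star_neg,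
    star_sum]
  congr 1
  refine Finset.sum_congr rfl fun i _ => ?_
  simp [isRealOp_shift _ ψ, star_sub, star_smul]

/-! ### Truncated potentials and measurability -/

/-- The truncation of a potential to values in `[-M, M]`. -/
def clamp (M : ℝ) (W : Site d → ℝ) : Site d → ℝ := fun x => max (-M) (min M (W x))

theorem abs_clamp_le {M : ℝ} (hM : 0 ≤ M) (W : Site d → ℝ) (x : Site d) : |clamp M W x| ≤ M := by
  rw [clamp, abs_le]
  exact ⟨le_max_left _ _, max_le (by linarith) (min_le_left _ _)⟩

theorem clamp_of_abs_le {M : ℝ} {W : Site d → ℝ} {x : Site d} (h : |W x| ≤ M) :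
    clamp M W x = W x := by
  rw [abs_le] at h
  rw [clamp, min_eq_right h.2, max_eq_right h.1]

theorem bddAbove_clamp {M : ℝ} (hM : 0 ≤ M) (W : Site d → ℝ) :
    BddAbove (Set.range fun x => |clamp M W x|) :=
  ⟨M, by rintro _ ⟨x, rfl⟩; exact abs_clamp_le hM W x⟩

theorem mulOp_clamp_apply {M : ℝ} (hM : 0 ≤ M) (W : Site d → ℝ) (ψ : L2 d) (x : Site d) :
    (mulOp (clamp M W) ψ : Site d → ℂ) x = (clamp M W x : ℂ) * (ψ : Site d → ℂ) x :=
  mulOp_apply (bddAbove_clamp hM W) ψ x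

theorem norm_sq_eq_tsum (ψ : L2 d) : ‖ψ‖ ^ 2 = ∑' x, ‖(ψ : Site d → ℂ) x‖ ^ 2 := by
  have := lp.norm_rpow_eq_tsum (p := 2) (by norm_num) ψ
  simpa using this

theorem summable_norm_sq (ψ : L2 d) : Summable fun x => ‖(ψ : Site d → ℂ) x‖ ^ 2 := by
  have := (lp.memℓp ψ).summable (p := 2) (by norm_num)
  simpa using this

/-- Dominated convergence: the potentials converge sitewise, differ by at most `2 * M`, and `ψ` is
square summable. Continuity is for the product topology and only strong. -/
theorem continuous_mulOp_clamp {M : ℝ} (hM : 0 ≤ M) (ψ : L2 d) :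
    Continuous fun W : Site d → ℝ => mulOp (clamp M W) ψ := by
  rw [continuous_iff_continuousAt]
  intro W₀
  rw [ContinuousAt, tendsto_iff_norm_sub_tendsto_zero]
  have key : Tendsto (fun W : Site d → ℝ => ‖mulOp (clamp M W) ψ - mulOp (clamp M W₀) ψ‖ ^ 2)
      (𝓝 W₀) (𝓝 0) := by
    simp_rw [norm_sq_eq_tsum]
    have h0 : (0 : ℝ) = ∑' x : Site d, (0 : ℝ) := by simp
    rw [h0]
    refine tendsto_tsum_of_dominated_convergence
      (bound := fun x => (2 * M) ^ 2 * ‖(ψ : Site d → ℂ) x‖ ^ 2)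
      ((summable_norm_sq ψ).mul_left _) ?_ ?_
    · intro x
      have hc : Continuous fun W : Site d → ℝ =>
          ‖(clamp M W x : ℂ) * (ψ : Site d → ℂ) x - (clamp M W₀ x : ℂ) * (ψ : Site d → ℂ) x‖ ^ 2 := by
        unfold clamp; fun_prop
      have := hc.tendsto W₀
      simpa [mulOp_clamp_apply hM] using this
    · refine Eventually.of_forall fun W x => ?_
      simp only [lp.coeFn_sub, Pi.sub_apply, mulOp_clamp_apply hM, ← sub_mul, norm_mul, norm_pow,
        norm_norm]
      rw [mul_pow]
      gcongr
      rw [← Complex.ofReal_sub, Complex.norm_real, Real.norm_eq_abs]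
      have h1 := abs_clamp_le hM W x
      have h2 := abs_clamp_le hM W₀ x
      rw [abs_le] at *
      constructor <;> linarith [h1.1, h1.2, h2.1, h2.2]
  have := key.sqrt
  simpa using this

theorem isSelfAdjoint_add_mulOp {K : L2 d →L[ℂ] L2 d} (hK : IsSelfAdjoint K) (V : Site d → ℝ) :
    IsSelfAdjoint (K + mulOp V) := hK.add (isSelfAdjoint_mulOp V)

/-- The resolvent identity applies the difference of potentials to the fixed vector `φ`, so strong
continuity and the bound 1/|Im z| on the other resolvent suffice. -/
theorem continuous_entry {M : ℝ} (hM : 0 ≤ M) {K : L2 d →L[ℂ] L2 d} (hK : IsSelfAdjoint K) {z : ℂ}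
    (hz : z.im ≠ 0) (x y : Site d) :
    Continuous fun W : Site d → ℝ => entry (K + mulOp (clamp M W)) z x y := by
  rw [continuous_iff_continuousAt]
  intro W₀
  rw [ContinuousAt, tendsto_iff_norm_sub_tendsto_zero]
  set φ := res (K + mulOp (clamp M W₀)) z (ket y) with hφ
  have hb : ∀ W : Site d → ℝ, ‖entry (K + mulOp (clamp M W)) z x y -
      entry (K + mulOp (clamp M W₀)) z x y‖ ≤
      |z.im|⁻¹ * ‖mulOp (clamp M W₀) φ - mulOp (clamp M W) φ‖ := by
    intro W
    have h1 := res_sub_res (isSelfAdjoint_add_mulOp hK (clamp M W))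
      (isSelfAdjoint_add_mulOp hK (clamp M W₀)) hz
    have h2 := congrArg (fun T : L2 d →L[ℂ] L2 d => T (ket y)) h1
    simp only [sub_apply, mul_apply_eq_comp,
      add_sub_add_left_eq_sub] at h2
    have h3 := congrArg (fun ψ : L2 d => (ψ : Site d → ℂ) x) h2
    simp only [lp.coeFn_sub, Pi.sub_apply] at h3
    rw [entry, entry, h3]
    exact (norm_apply_le _ _).trans (norm_res_apply_le (isSelfAdjoint_add_mulOp hK _) hz _)
  refine squeeze_zero (fun _ => norm_nonneg _) hb ?_
  have hc : Continuous fun W : Site d → ℝ =>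
      |z.im|⁻¹ * ‖mulOp (clamp M W₀) φ - mulOp (clamp M W) φ‖ := by
    have := continuous_mulOp_clamp hM φ
    fun_prop
  have := hc.tendsto W₀
  simpa using this

theorem measurable_entry {M : ℝ} (hM : 0 ≤ M) {K : L2 d →L[ℂ] L2 d} (hK : IsSelfAdjoint K) {z : ℂ}
    (hz : z.im ≠ 0) (x y : Site d) :
    Measurable fun W : Site d → ℝ => entry (K + mulOp (clamp M W)) z x y :=
  (continuous_entry hM hK hz x y).measurable

/-! ### Negative moments of the single-site law -/

/-- A law on the line that is supported in `[-M, M]` and has a bounded density. -/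
structure IsBoundedLaw (M : ℝ) (ν : Measure ℝ) : Prop where
  nonneg : 0 ≤ M
  ae_abs_le : ∀ᵐ t ∂ν, |t| ≤ M
  le_volume : ∃ D : ℝ≥0, ν ≤ D • volume

theorem lintegral_Ioo_enorm_rpow_neg_lt_top {s : ℝ} (hs1 : s < 1) :
    ∫⁻ u in Set.Ioo (-1 : ℝ) 1, ‖u‖ₑ ^ (-s) < ⊤ := by
  have h1 : ∫⁻ u in Set.Ioo (0 : ℝ) 1, ‖u‖ₑ ^ (-s) < ⊤ := by
    have h := ((intervalIntegral.integrableOn_Ioo_rpow_iff (s := -s) (t := 1) one_pos).2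
      (by linarith)).2
    rw [hasFiniteIntegral_iff_enorm] at h
    refine lt_of_le_of_lt (le_of_eq (setLIntegral_congr_fun measurableSet_Ioo fun u hu => ?_)) h
    rw [Real.enorm_of_nonneg hu.1.le, Real.enorm_of_nonneg (Real.rpow_nonneg hu.1.le _),
      ENNReal.ofReal_rpow_of_pos hu.1]
  have h2 : ∫⁻ u in Set.Ioo (-1 : ℝ) 0, ‖u‖ₑ ^ (-s) < ⊤ := by
    have h := (Measure.measurePreserving_neg (volume : Measure ℝ)).setLIntegral_comp_preimage
      (s := Set.Ioo (0 : ℝ) 1) measurableSet_Ioo (f := fun u => ‖u‖ₑ ^ (-s)) (by fun_prop)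
    have hpre : Neg.neg ⁻¹' Set.Ioo (0 : ℝ) 1 = Set.Ioo (-1 : ℝ) 0 := by
      ext u; simp only [Set.mem_preimage, Set.mem_Ioo]
      constructor <;> rintro ⟨a, b⟩ <;> constructor <;> linarith
    rw [hpre] at h
    simp only [enorm_neg] at h
    rw [h]; exact h1
  have hsub : Set.Ioo (-1 : ℝ) 1 ⊆ Set.Ioo (-1 : ℝ) 0 ∪ {0} ∪ Set.Ioo (0 : ℝ) 1 := by
    intro u hu
    rcases lt_trichotomy u 0 with h | h | h
    · exact Or.inl (Or.inl ⟨hu.1, h⟩)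
    · exact Or.inl (Or.inr h)
    · exact Or.inr ⟨h, hu.2⟩
  refine lt_of_le_of_lt (lintegral_mono_set hsub) ?_
  refine lt_of_le_of_lt (lintegral_union_le _ _ _) ?_
  refine ENNReal.add_lt_top.2 ⟨lt_of_le_of_lt (lintegral_union_le _ _ _) ?_, h1⟩
  refine ENNReal.add_lt_top.2 ⟨h2, ?_⟩
  rw [setLIntegral_measure_zero _ _ (by simp)]
  exact ENNReal.zero_lt_top

/-- Where |t + c| < 1 the law is dominated by a multiple of Lebesgue measure, whose translation
invariance makes the bound uniform in `c`; elsewhere the integrand is at most 1. -/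
theorem exists_lintegral_enorm_add_rpow_le {M : ℝ} {ν : Measure ℝ} [IsProbabilityMeasure ν]
    (hν : IsBoundedLaw M ν) {s : ℝ} (hs0 : 0 < s) (hs1 : s < 1) :
    ∃ C : ℝ≥0, ∀ c : ℝ, ∫⁻ t, ‖max (-M) (min M t) + c‖ₑ ^ (-s) ∂ν ≤ C := by
  obtain ⟨D, hD⟩ := hν.le_volume
  have hfin := lintegral_Ioo_enorm_rpow_neg_lt_top hs1
  set I := ∫⁻ u in Set.Ioo (-1 : ℝ) 1, ‖u‖ₑ ^ (-s) with hI
  refine ⟨(1 + D * I).toNNReal, fun c => ?_⟩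
  rw [ENNReal.coe_toNNReal (by finiteness)]
  have h1 : ∫⁻ t, ‖max (-M) (min M t) + c‖ₑ ^ (-s) ∂ν = ∫⁻ t, ‖t + c‖ₑ ^ (-s) ∂ν := by
    refine lintegral_congr_ae ?_
    filter_upwards [hν.ae_abs_le] with t ht
    rw [abs_le] at ht
    rw [min_eq_right ht.2, max_eq_right ht.1]
  rw [h1]
  calc ∫⁻ t, ‖t + c‖ₑ ^ (-s) ∂ν
      ≤ ∫⁻ t, (1 + (Set.Ioo (-1 : ℝ) 1).indicator (fun u => ‖u‖ₑ ^ (-s)) (t + c)) ∂ν := by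
        refine lintegral_mono fun t => ?_
        simp only
        by_cases ht : t + c ∈ Set.Ioo (-1 : ℝ) 1
        · rw [Set.indicator_of_mem ht]; exact le_add_self
        · rw [Set.indicator_of_notMem ht, add_zero]
          have : 1 ≤ ‖t + c‖ₑ := by
            rw [Real.enorm_eq_ofReal_abs, ← ENNReal.ofReal_one]
            apply ENNReal.ofReal_le_ofReal
            by_contra hlt
            exact ht (abs_lt.1 (not_le.1 hlt))
          rw [ENNReal.rpow_neg]
          exact ENNReal.inv_le_one.2 (ENNReal.one_le_rpow this hs0)
    _ = 1 + ∫⁻ t, (Set.Ioo (-1 : ℝ) 1).indicator (fun u => ‖u‖ₑ ^ (-s)) (t + c) ∂ν := by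
        rw [lintegral_add_left measurable_const]; simp
    _ ≤ 1 + D * I := by
        gcongr
        calc _ ≤ ∫⁻ t, (Set.Ioo (-1 : ℝ) 1).indicator (fun u => ‖u‖ₑ ^ (-s)) (t + c)
              ∂(D • volume) := lintegral_mono' hD le_rfl
          _ = D * ∫⁻ t, (Set.Ioo (-1 : ℝ) 1).indicator (fun u => ‖u‖ₑ ^ (-s)) (t + c) := by
              rw [lintegral_smul_measure]; rfl
          _ = D * I := by
              rw [lintegral_add_right_eq_self
                (fun t => (Set.Ioo (-1 : ℝ) 1).indicator (fun u : ℝ => ‖u‖ₑ ^ (-s)) t) c,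
                lintegral_indicator measurableSet_Ioo]

/-! ### Resampling the potential on a set of sites -/

/-- The potential equal to `W` on `F` and to `V` off `F`. -/
def mix (F : Set (Site d)) (W V : Site d → ℝ) : Site d → ℝ :=
  open Classical in fun x => if x ∈ F then W x else V x

theorem mix_of_mem {F : Set (Site d)} {x : Site d} (hx : x ∈ F) (W V : Site d → ℝ) :
    mix F W V x = W x := by rw [mix, if_pos hx]

theorem mix_of_notMem {F : Set (Site d)} {x : Site d} (hx : x ∉ F) (W V : Site d → ℝ) :
    mix F W V x = V x := by rw [mix, if_neg hx]

theorem mix_univ (W V : Site d → ℝ) : mix Set.univ W V = W := by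
  ext x; exact mix_of_mem (Set.mem_univ x) W V

theorem measurable_mix (F : Set (Site d)) :
    Measurable fun p : (Site d → ℝ) × (Site d → ℝ) => mix F p.1 p.2 := by
  refine measurable_pi_iff.2 fun x => ?_
  by_cases hx : x ∈ F
  · simp only [mix_of_mem hx]; fun_prop
  · simp only [mix_of_notMem hx]; fun_prop

/-- The joint law of independent site potentials with common law `ν`. -/
abbrev iidLaw (d : ℕ) (ν : Measure ℝ) [IsProbabilityMeasure ν] : Measure (Site d → ℝ) :=
  Measure.infinitePi fun _ : Site d => ν

/-- On a finite cylinder, the sites in `F` and those off `F` read independent copies, so the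
probability splits into the two corresponding products. -/
theorem map_mix (ν : Measure ℝ) [IsProbabilityMeasure ν] (F : Set (Site d)) :
    ((iidLaw d ν).prod (iidLaw d ν)).map (fun p => mix F p.2 p.1) = iidLaw d ν := by
  classical
  refine Measure.eq_infinitePi _ fun s t ht => ?_
  have hm : Measurable fun p : (Site d → ℝ) × (Site d → ℝ) => mix F p.2 p.1 :=
    (measurable_mix F).comp measurable_swap
  rw [Measure.map_apply hm (MeasurableSet.pi s.countable_toSet fun i _ => ht i)]
  have hpre : (fun p : (Site d → ℝ) × (Site d → ℝ) => mix F p.2 p.1) ⁻¹' (Set.pi s t) =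
      (Set.pi (s.filter fun i => i ∉ F : Finset _) t) ×ˢ
        (Set.pi (s.filter fun i => i ∈ F : Finset _) t) := by
    ext p
    simp only [Set.mem_preimage, Set.mem_pi, Set.mem_prod, Finset.coe_filter, Set.mem_ofPred_eq,
      Finset.mem_coe]
    constructor
    · intro h
      exact ⟨fun i hi => by have := h i hi.1; rwa [mix_of_notMem hi.2] at this,
        fun i hi => by have := h i hi.1; rwa [mix_of_mem hi.2] at this⟩
    · intro h i hi
      by_cases hF : i ∈ F
      · rw [mix_of_mem hF]; exact h.2 i ⟨hi, hF⟩
      · rw [mix_of_notMem hF]; exact h.1 i ⟨hi, hF⟩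
  rw [hpre, Measure.prod_prod, Measure.infinitePi_pi _ fun i _ => ht i,
    Measure.infinitePi_pi _ fun i _ => ht i, mul_comm, Finset.prod_filter_mul_prod_filter_not]

theorem lintegral_mix (ν : Measure ℝ) [IsProbabilityMeasure ν] (F : Set (Site d))
    {h : (Site d → ℝ) → ℝ≥0∞} (hh : Measurable h) :
    ∫⁻ V, ∫⁻ W, h (mix F W V) ∂iidLaw d ν ∂iidLaw d ν = ∫⁻ W, h W ∂iidLaw d ν := by
  have hm : Measurable fun p : (Site d → ℝ) × (Site d → ℝ) => mix F p.2 p.1 :=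
    (measurable_mix F).comp measurable_swap
  conv_rhs => rw [← map_mix ν F, lintegral_map hh hm]
  rw [lintegral_prod (fun p : (Site d → ℝ) × (Site d → ℝ) => h (mix F p.2 p.1))
    (hh.comp hm).aemeasurable]

/-! ### Krein's formula and the a priori moment bound -/

/-- Passing to the real part moves the singularity onto the real axis, where the single-site
integral is bounded uniformly in its location. -/
theorem norm_mul_abs_add_re_le {G c : ℂ} {t B : ℝ} (h : ‖G * (t + c)‖ ≤ B) :
    ‖G‖ * |t + c.re| ≤ B := by
  refine le_trans ?_ h
  rw [norm_mul]
  refine mul_le_mul_of_nonneg_left ?_ (norm_nonneg _)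
  have := Complex.abs_re_le_norm ((t : ℂ) + c)
  simpa using this

/-- Krein's formula for a rank two perturbation implies that the off-diagonal matrix element is
bounded by the reciprocal of one of three affine functions of the two coupling constants. -/
theorem two_site_bound {p q b G g h : ℂ} {t u : ℝ} (h1 : G = b - t * p * G - u * b * g)
    (h2 : g = q - t * b * G - u * q * g) (h3 : p = h + t * h * p + u * G * b) :
    ‖G‖ * |u + ((1 + t * p) / (q + t * (p * q - b ^ 2))).re| ≤ 2 ∨
      ‖G‖ * |t + ((1 + u * q) / (p + u * (p * q - b ^ 2))).re| ≤ 2 ∨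
      ‖G‖ * |t + (q / (p * q - b ^ 2)).re| ≤ 2 := by
  set Δ := p * q - b ^ 2 with hΔ
  -- Eliminating `g` leaves G = b/N, with N the two-by-two Krein determinant.
  have hN : G * ((1 + t * p) * (1 + u * q) - t * u * b ^ 2) = b := by
    linear_combination (1 + u * q) * h1 - u * b * h2
  -- For b = 0 only G(1 + tp) = 0 is left. The relation `h3` excludes 1 + tp = 0, since it would
  -- force p = 0.
  rcases eq_or_ne b 0 with rfl | hb
  · have hG : G = 0 := by
      by_contra hG
      have e1 : 1 + t * p = 0 := by
        have : G * (1 + t * p) = 0 := by linear_combination h1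
        exact (mul_eq_zero.1 this).resolve_left hG
      have e2 : p = 0 := by linear_combination h3 + h * e1
      rw [e2] at e1
      simp at e1
    left
    simp [hG]
  have hbpos : 0 < ‖b‖ := norm_pos_iff.2 hb
  have hNeq : ∀ v w r : ℂ, r ≠ 0 → ‖b‖ / 2 ≤ ‖r‖ → G * (r * (v + w / r)) = b →
      ‖G * (v + w / r)‖ ≤ 2 := by
    intro v w r hr hrb e
    have hrpos : 0 < ‖r‖ := norm_pos_iff.2 hr
    have : ‖r‖ * ‖G * (v + w / r)‖ = ‖b‖ := by
      rw [← norm_mul]; congr 1; linear_combination e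
    nlinarith [norm_nonneg (G * (v + w / r))]
  -- N is affine in u with slope q + tΔ, and affine in t with slope p + uΔ. A slope of size at least
  -- |b|/2 gives the bound directly.
  by_cases c1 : ‖b‖ / 2 ≤ ‖q + t * Δ‖
  · left
    have hr : q + t * Δ ≠ 0 := by
      intro h0; rw [h0, norm_zero] at c1; linarith
    refine norm_mul_abs_add_re_le (hNeq _ _ _ hr c1 ?_)
    rw [mul_add, mul_div_cancel₀ _ hr, hΔ]
    linear_combination hN
  by_cases c2 : ‖b‖ / 2 ≤ ‖p + u * Δ‖
  · right; left
    have hr : p + u * Δ ≠ 0 := by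
      intro h0; rw [h0, norm_zero] at c2; linarith
    refine norm_mul_abs_add_re_le (hNeq _ _ _ hr c2 ?_)
    rw [mul_add, mul_div_cancel₀ _ hr, hΔ]
    linear_combination hN
  -- When both slopes are below |b|/2, the identity ΔN = (q + tΔ)(p + uΔ) - b² keeps |ΔN| above
  -- 3|b|²/4. Hence |G| is at most of order |Δ|/|b|, while |t + q/Δ| is below |b|/(2|Δ|).
  right; right
  rw [not_le] at c1 c2
  refine norm_mul_abs_add_re_le ?_
  set N := (1 + t * p) * (1 + u * q) - t * u * b ^ 2 with hNdef
  have e1 : Δ * N = (q + t * Δ) * (p + u * Δ) - b ^ 2 := by rw [hNdef, hΔ]; ring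
  have e2 : 3 / 4 * ‖b‖ ^ 2 ≤ ‖Δ‖ * ‖N‖ := by
    rw [← norm_mul, e1]
    have f1 : ‖(q + t * Δ) * (p + u * Δ)‖ ≤ ‖b‖ / 2 * (‖b‖ / 2) := by
      rw [norm_mul]; gcongr
    have f2 := norm_sub_norm_le (b ^ 2) ((q + t * Δ) * (p + u * Δ))
    rw [norm_sub_rev, norm_pow] at f2
    nlinarith
  have hΔ0 : Δ ≠ 0 := by
    intro h0; rw [h0, norm_zero, zero_mul] at e2
    nlinarith [pow_pos hbpos 2]
  have hΔpos : 0 < ‖Δ‖ := norm_pos_iff.2 hΔ0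
  have e3 : ‖G‖ * ‖N‖ = ‖b‖ := by rw [← norm_mul, hN]
  have e4 : ‖Δ‖ * ‖(t : ℂ) + q / Δ‖ = ‖q + t * Δ‖ := by
    rw [← norm_mul, mul_add, mul_div_cancel₀ _ hΔ0]; congr 1; ring
  rw [norm_mul]
  have e5 : 3 / 4 * ‖b‖ * ‖G‖ ≤ ‖Δ‖ := by
    have : 3 / 4 * ‖b‖ ^ 2 * ‖G‖ ≤ ‖Δ‖ * ‖b‖ := by
      calc 3 / 4 * ‖b‖ ^ 2 * ‖G‖ ≤ ‖Δ‖ * ‖N‖ * ‖G‖ := by gcongr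
        _ = ‖Δ‖ * ‖b‖ := by rw [mul_assoc, mul_comm ‖N‖, e3]
    nlinarith
  have e6 : ‖Δ‖ * (‖G‖ * ‖(t : ℂ) + q / Δ‖) ≤ ‖Δ‖ * 2 := by
    calc ‖Δ‖ * (‖G‖ * ‖(t : ℂ) + q / Δ‖) = ‖G‖ * ‖q + t * Δ‖ := by rw [← e4]; ring
      _ ≤ ‖G‖ * (‖b‖ / 2) := by gcongr
      _ ≤ ‖Δ‖ * 2 := by nlinarith [norm_nonneg G]
  exact le_of_mul_le_mul_left e6 hΔpos

theorem one_site_bound {p G : ℂ} {t : ℝ} (h : G = p - t * p * G) :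
    ‖G‖ * |t + p⁻¹.re| ≤ 2 := by
  refine norm_mul_abs_add_re_le ?_
  rcases eq_or_ne p 0 with rfl | hp
  · have : G = 0 := by simpa using h
    simp [this]
  · have : G * (t + p⁻¹) = 1 := by
      field_simp
      linear_combination h
    rw [this]; simp

theorem enorm_rpow_le_of_norm_mul_abs_le {G : ℂ} {v s : ℝ} (hs : 0 ≤ s) (h : ‖G‖ * |v| ≤ 2) :
    ‖G‖ₑ ^ s ≤ 2 ^ s * ‖v‖ₑ ^ (-s) := by
  rw [ENNReal.rpow_neg, ← div_eq_mul_inv, ← ENNReal.div_rpow_of_nonneg _ _ hs]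
  refine ENNReal.rpow_le_rpow ?_ hs
  rw [ENNReal.le_div_iff_mul_le (Or.inr (by norm_num)) (Or.inl (by simp))]
  rw [← ofReal_norm, Real.enorm_eq_ofReal_abs, ← ENNReal.ofReal_mul (norm_nonneg _)]
  calc ENNReal.ofReal (‖G‖ * |v|) ≤ ENNReal.ofReal 2 := ENNReal.ofReal_le_ofReal h
    _ = 2 := by simp

theorem mulOp_sub_mulOp {U V : Site d → ℝ} (hU : BddAbove (Set.range fun x => |U x|))
    (hV : BddAbove (Set.range fun x => |V x|)) {F : Finset (Site d)}
    (h : ∀ x, x ∉ F → U x = V x) :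
    mulOp U - mulOp V = ∑ x ∈ F, ((U x - V x : ℝ) : ℂ) • ketbra x x := by
  ext ψ x
  simp only [sub_apply, sum_apply, smul_apply, ketbra_apply, lp.coeFn_sub, Pi.sub_apply,
    mulOp_apply hU, mulOp_apply hV, lp.coeFn_sum, Finset.sum_apply, lp.coeFn_smul, Pi.smul_apply,
    ket_apply, smul_eq_mul, mul_ite, mul_one, mul_zero, Finset.sum_ite_eq]
  split_ifs with hx
  · push_cast; ring
  · rw [h x hx]; ring

theorem entry_sub_entry {A B : L2 d →L[ℂ] L2 d} (hA : IsSelfAdjoint A) (hB : IsSelfAdjoint B)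
    {z : ℂ} (hz : z.im ≠ 0) {ι : Type*} (I : Finset ι) (c : ι → ℂ) (a b : ι → Site d)
    (h : B - A = ∑ i ∈ I, c i • ketbra (a i) (b i)) (x y : Site d) :
    entry A z x y - entry B z x y = ∑ i ∈ I, c i * (entry A z x (a i) * entry B z (b i) y) := by
  have h1 := congrArg (fun T : L2 d →L[ℂ] L2 d => (T (ket y) : Site d → ℂ) x)
    (res_sub_res hA hB hz)
  rw [h] at h1
  simp only [sub_apply, lp.coeFn_sub, Pi.sub_apply, mul_apply_eq_comp] at h1
  rw [entry, entry, h1]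
  simp only [sum_apply, smul_apply, ketbra_apply, map_sum, map_smul, lp.coeFn_sum,
    Finset.sum_apply, lp.coeFn_smul, Pi.smul_apply, smul_eq_mul]
  refine Finset.sum_congr rfl fun i _ => ?_
  rw [entry, entry]; ring

/-- The moment bound at two fixed sites, all other potential values being frozen. -/
theorem exists_enorm_entry_rpow_le {K : L2 d →L[ℂ] L2 d} (hK : IsSelfAdjoint K) (hR : IsRealOp K)
    {M : ℝ} (hM : 0 ≤ M) {z : ℂ} (hz : z.im ≠ 0) {s : ℝ} (hs : 0 ≤ s) (U : Site d → ℝ)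
    (x y : Site d) :
    ∃ c₁ c₂ : ℝ → ℝ, ∃ c₃ : ℝ, Measurable c₁ ∧ Measurable c₂ ∧
      (x = y → c₁ = 0 ∧ c₂ = 0) ∧ ∀ W : Site d → ℝ,
      (∀ w, w ≠ x → w ≠ y → W w = U w) →
      ‖entry (K + mulOp (clamp M W)) z x y‖ₑ ^ s ≤
        2 ^ s * (‖clamp M W y + c₁ (clamp M W x)‖ₑ ^ (-s) +
          ‖clamp M W x + c₂ (clamp M W y)‖ₑ ^ (-s) + ‖clamp M W x + c₃‖ₑ ^ (-s)) := by
  classical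
  -- The potential is switched off at both sites, so the reference elements `p`, `q`, `b` do not
  -- depend on the two coupling constants.
  set U₀ : Site d → ℝ := clamp M fun w => if w = x ∨ w = y then 0 else U w with hU₀
  have hbU := bddAbove_clamp hM fun w => if w = x ∨ w = y then 0 else U w
  have hA₀ := isSelfAdjoint_add_mulOp hK U₀
  have hzero : clamp M (fun w => if w = x ∨ w = y then 0 else U w) x = 0 := by
    rw [clamp_of_abs_le] <;> simp [hM]
  have hzero' : clamp M (fun w => if w = x ∨ w = y then 0 else U w) y = 0 := by
    rw [clamp_of_abs_le] <;> simp [hM]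
  have hsupp : ∀ W : Site d → ℝ, (∀ w, w ≠ x → w ≠ y → W w = U w) →
      ∀ w, w ∉ ({x, y} : Finset (Site d)) → clamp M W w = U₀ w := by
    intro W hW w hw
    simp only [Finset.mem_insert, Finset.mem_singleton, not_or] at hw
    rw [hU₀, clamp, clamp, hW w hw.1 hw.2, if_neg (by tauto)]
  have hdiff : ∀ W : Site d → ℝ, (∀ w, w ≠ x → w ≠ y → W w = U w) →
      (K + mulOp (clamp M W)) - (K + mulOp U₀) =
        ∑ w ∈ {x, y}, ((clamp M W w : ℝ) : ℂ) • ketbra w w := by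
    intro W hW
    rw [add_sub_add_left_eq_sub, mulOp_sub_mulOp (bddAbove_clamp hM W) hbU (hsupp W hW)]
    refine Finset.sum_congr rfl fun w hw => ?_
    have : U₀ w = 0 := by
      rcases Finset.mem_insert.1 hw with rfl | hw
      · exact hzero
      · rw [Finset.mem_singleton.1 hw]; exact hzero'
    rw [← hU₀, this, sub_zero]
  rcases eq_or_ne x y with rfl | hxy
  -- On the diagonal the one-site formula supplies the third term. The first two are padding, and
  -- zero shifts keep their integrals bounded.
  · refine ⟨0, 0, (entry (K + mulOp U₀) z x x)⁻¹.re, measurable_const,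
      measurable_const, fun _ => ⟨rfl, rfl⟩, fun W hW => ?_⟩
    have h := entry_sub_entry hA₀ (isSelfAdjoint_add_mulOp hK (clamp M W)) hz _ _ id id
      (hdiff W hW) x x
    simp only [Finset.pair_eq_singleton, Finset.sum_singleton, id] at h
    refine (enorm_rpow_le_of_norm_mul_abs_le hs
      (one_site_bound (p := entry (K + mulOp U₀) z x x) (t := clamp M W x) ?_)).trans ?_
    · linear_combination -h
    · gcongr
      exact le_add_self
  · set p := entry (K + mulOp U₀) z x x
    set q := entry (K + mulOp U₀) z y y
    set b := entry (K + mulOp U₀) z x y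
    have hsymm : entry (K + mulOp U₀) z y x = b :=
      entry_symm hA₀ (hR.add (isRealOp_mulOp _)) hz y x
    refine ⟨fun t => ((1 + t * p) / (q + t * (p * q - b ^ 2))).re,
      fun u => ((1 + u * q) / (p + u * (p * q - b ^ 2))).re, (q / (p * q - b ^ 2)).re,
      by fun_prop, by fun_prop, fun h => absurd h hxy, fun W hW => ?_⟩
    have hA := isSelfAdjoint_add_mulOp hK (clamp M W)
    have h := entry_sub_entry hA₀ hA hz _ _ id id (hdiff W hW)
    simp only [Finset.sum_pair hxy, id] at h
    have hd' : (K + mulOp U₀) - (K + mulOp (clamp M W)) =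
        ∑ w ∈ {x, y}, (-((clamp M W w : ℝ) : ℂ)) • ketbra w w := by
      rw [← neg_sub, hdiff W hW, ← Finset.sum_neg_distrib]; simp
    have h' := entry_sub_entry hA hA₀ hz _ _ id id hd' x x
    simp only [Finset.sum_pair hxy, id] at h'
    have h1 := h x y
    have h2 := h y y
    rw [hsymm] at h2 h'
    have := two_site_bound (p := p) (q := q) (b := b) (G := entry (K + mulOp (clamp M W)) z x y)
      (g := entry (K + mulOp (clamp M W)) z y y) (h := entry (K + mulOp (clamp M W)) z x x)
      (t := clamp M W x) (u := clamp M W y) (by linear_combination -h1)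
      (by linear_combination -h2) (by linear_combination -h')
    rcases this with H | H | H
    · refine (enorm_rpow_le_of_norm_mul_abs_le hs H).trans ?_
      gcongr
      exact le_add_right le_self_add
    · refine (enorm_rpow_le_of_norm_mul_abs_le hs H).trans ?_
      gcongr
      exact le_add_right le_add_self
    · refine (enorm_rpow_le_of_norm_mul_abs_le hs H).trans ?_
      gcongr
      exact le_add_self

theorem mix_mix_of_subset {E F : Set (Site d)} (h : E ⊆ F) (W' W V : Site d → ℝ) {x : Site d}
    (hx : x ∈ E) : mix F (mix E W' W) V x = W' x := by
  rw [mix_of_mem (h hx), mix_of_mem hx]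

/-- The a priori bound on fractional moments of the Green function. -/
theorem exists_lintegral_entry_rpow_le {M : ℝ} {ν : Measure ℝ} [IsProbabilityMeasure ν]
    (hν : IsBoundedLaw M ν) {s : ℝ} (hs0 : 0 < s) (hs1 : s < 1) :
    ∃ C : ℝ≥0, ∀ K : L2 d →L[ℂ] L2 d, IsSelfAdjoint K → IsRealOp K → ∀ z : ℂ, z.im ≠ 0 →
      ∀ (F : Set (Site d)) (V : Site d → ℝ) (x y : Site d), x ∈ F → y ∈ F →
      ∫⁻ W, ‖entry (K + mulOp (clamp M (mix F W V))) z x y‖ₑ ^ s ∂iidLaw d ν ≤ C := by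
  obtain ⟨C, hC⟩ := exists_lintegral_enorm_add_rpow_le hν hs0 hs1
  refine ⟨2 ^ s * (3 * C), fun K hK hR z hz F V x y hx hy => ?_⟩
  have hmV : Measurable fun W => mix F W V :=
    (measurable_mix F).comp (measurable_id.prodMk measurable_const)
  have hmeas : Measurable fun W => ‖entry (K + mulOp (clamp M (mix F W V))) z x y‖ₑ ^ s :=
    (((measurable_entry hν.nonneg hK hz x y).comp hmV).enorm).pow_const s
  have hsub : ({x, y} : Set (Site d)) ⊆ F := by
    rintro w (rfl | rfl) <;> assumption
  -- Conditioning on all values except those at `x` and `y` reduces the claim to the two-site bound.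
  rw [← lintegral_mix ν {x, y} hmeas]
  have key : ∀ W : Site d → ℝ, ∫⁻ W', ‖entry (K + mulOp (clamp M
      (mix F (mix {x, y} W' W) V))) z x y‖ₑ ^ s ∂iidLaw d ν ≤ 2 ^ s * (3 * C) := by
    intro W
    obtain ⟨c₁, c₂, c₃, hc₁, hc₂, hc, hb⟩ :=
      exists_enorm_entry_rpow_le hK hR hν.nonneg hz hs0.le (mix F W V) x y
    set k : ℝ → ℝ := fun t => max (-M) (min M t) with hk
    have hkm : Measurable k := by fun_prop
    have hcl : ∀ W' w, w ∈ ({x, y} : Set (Site d)) →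
        clamp M (mix F (mix {x, y} W' W) V) w = k (W' w) := by
      intro W' w hw
      rw [clamp, mix_mix_of_subset hsub W' W V hw]
    have hle : ∀ W', ‖entry (K + mulOp (clamp M (mix F (mix {x, y} W' W) V))) z x y‖ₑ ^ s ≤
        2 ^ s * (‖k (W' y) + c₁ (k (W' x))‖ₑ ^ (-s) + ‖k (W' x) + c₂ (k (W' y))‖ₑ ^ (-s) +
          ‖k (W' x) + c₃‖ₑ ^ (-s)) := by
      intro W'
      have := hb (mix F (mix {x, y} W' W) V) (by
        intro w hwx hwy
        by_cases hw : w ∈ F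
        · rw [mix_of_mem hw, mix_of_mem hw, mix_of_notMem (by simp [hwx, hwy])]
        · rw [mix_of_notMem hw, mix_of_notMem hw])
      rwa [hcl W' x (by simp), hcl W' y (by simp)] at this
    have hone : ∀ (w : Site d) (c : ℝ),
        ∫⁻ W', ‖k (W' w) + c‖ₑ ^ (-s) ∂iidLaw d ν ≤ C := by
      intro w c
      have := (measurePreserving_eval_infinitePi (fun _ : Site d => ν) w).lintegral_comp
        (f := fun t => ‖k t + c‖ₑ ^ (-s)) (by fun_prop)
      simp only [Function.eval] at this
      rw [this]
      exact hC c
    have htwo : ∀ (v w : Site d) (c : ℝ → ℝ), Measurable c → (v = w → c = 0) →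
        ∫⁻ W', ‖k (W' v) + c (k (W' w))‖ₑ ^ (-s) ∂iidLaw d ν ≤ C := by
      intro v w c hc hcw
      rcases eq_or_ne v w with h | h
      · simp only [hcw h, Pi.zero_apply]
        exact hone v 0
      -- At distinct sites the two values are independent: the value at `w` is frozen, and the bound
      -- uniform in the shift is applied to the value at `v`.
      · have h1 := Measure.infinitePi_map_eval_prod (P := fun _ : Site d => ν) h.symm
        have h2 : Measurable fun p : ℝ × ℝ => ‖k p.2 + c (k p.1)‖ₑ ^ (-s) := by fun_prop
        have h3 := lintegral_map (μ := iidLaw d ν) (g := fun W' => (W' w, W' v)) h2 (by fun_prop)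
        rw [h1] at h3
        rw [← h3, lintegral_prod _ h2.aemeasurable]
        refine (lintegral_mono fun t => hC (c (k t))).trans ?_
        simp
    refine (lintegral_mono hle).trans ?_
    rw [lintegral_const_mul _ (by fun_prop), lintegral_add_left (by fun_prop),
      lintegral_add_left (by fun_prop)]
    gcongr
    calc _ ≤ (C : ℝ≥0∞) + C + C := by
          gcongr
          · exact htwo y x c₁ hc₁ fun h => (hc h.symm).1
          · exact htwo x y c₂ hc₂ fun h => (hc h).2
          · exact hone x c₃
      _ = 3 * C := by ring
  calc _ ≤ ∫⁻ _, (2 ^ s * (3 * C) : ℝ≥0∞) ∂iidLaw d ν := lintegral_mono key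
    _ = _ := by simp [ENNReal.coe_rpow_of_nonneg _ hs0.le]

/-! ### Decoupling a finite region and geometric resolvent identities -/

/-- The matrix element `⟨x| (A - z)⁻¹ T (B - z)⁻¹ |y⟩`, as a linear function of `T`. -/
def sandwich (A B : L2 d →L[ℂ] L2 d) (z : ℂ) (x y : Site d) : (L2 d →L[ℂ] L2 d) →ₗ[ℂ] ℂ where
  toFun T := (res A z (T (res B z (ket y))) : Site d → ℂ) x
  map_add' S T := by simp
  map_smul' c T := by simp

theorem sandwich_ketbra (A B : L2 d →L[ℂ] L2 d) (z : ℂ) (x y a b : Site d) :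
    sandwich A B z x y (ketbra a b) = entry A z x a * entry B z b y := by
  change (res A z (ketbra a b (res B z (ket y))) : Site d → ℂ) x = _
  rw [ketbra_apply, map_smul, lp.coeFn_smul, Pi.smul_apply, smul_eq_mul, mul_comm]
  rfl

theorem entry_sub_entry_eq_sandwich {A B : L2 d →L[ℂ] L2 d} (hA : IsSelfAdjoint A)
    (hB : IsSelfAdjoint B) {z : ℂ} (hz : z.im ≠ 0) (x y : Site d) :
    entry A z x y - entry B z x y = sandwich A B z x y (B - A) :=
  congrArg (fun T : L2 d →L[ℂ] L2 d => (T (ket y) : Site d → ℂ) x) (res_sub_res hA hB hz)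

theorem star_ketbra (x y : Site d) : star (ketbra x y) = ketbra y x := by
  rw [ketbra, ketbra, ContinuousLinearMap.star_eq_adjoint, InnerProductSpace.adjoint_rankOne]

/-- The projection onto the functions supported in `Λ`. -/
def proj (Λ : Finset (Site d)) : L2 d →L[ℂ] L2 d := ∑ x ∈ Λ, ketbra x x

theorem proj_apply (Λ : Finset (Site d)) (ψ : L2 d) :
    proj Λ ψ = ∑ x ∈ Λ, (ψ : Site d → ℂ) x • ket x := by
  simp only [proj, sum_apply, ketbra_apply]

theorem proj_apply_apply (Λ : Finset (Site d)) (ψ : L2 d) (x : Site d) :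
    (proj Λ ψ : Site d → ℂ) x = if x ∈ Λ then (ψ : Site d → ℂ) x else 0 := by
  simp only [proj_apply, lp.coeFn_sum, Finset.sum_apply, lp.coeFn_smul, Pi.smul_apply, ket_apply,
    smul_eq_mul, mul_ite, mul_one, mul_zero, Finset.sum_ite_eq]

theorem proj_ket (Λ : Finset (Site d)) (x : Site d) :
    proj Λ (ket x) = if x ∈ Λ then ket x else 0 := by
  ext y
  rw [proj_apply_apply]
  by_cases hx : x ∈ Λ
  · by_cases hy : y = x
    · subst hy; simp [hx]
    · simp [hx, ket_apply, hy]
  · by_cases hy : y = x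
    · subst hy; simp [hx]
    · simp [hx, ket_apply, hy]

theorem isSelfAdjoint_proj (Λ : Finset (Site d)) : IsSelfAdjoint (proj Λ) := by
  rw [IsSelfAdjoint, proj, star_sum]
  simp only [star_ketbra]

theorem proj_mul_proj (Λ : Finset (Site d)) : proj Λ * proj Λ = proj Λ := by
  ext ψ x
  simp only [mul_apply_eq_comp, proj_apply_apply]
  split_ifs <;> rfl

theorem isRealOp_proj (Λ : Finset (Site d)) : IsRealOp (proj Λ) := by
  intro ψ
  ext x
  simp only [proj_apply_apply, lp.star_apply]
  split_ifs <;> simp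

theorem commute_proj_mulOp (Λ : Finset (Site d)) (V : Site d → ℝ) :
    Commute (proj Λ) (mulOp V) := by
  by_cases h : BddAbove (Set.range fun x => |V x|)
  · ext ψ x
    simp only [mul_apply_eq_comp, proj_apply_apply, mulOp_apply h]
    split_ifs <;> simp
  · rw [mulOp, dif_neg h]; exact Commute.zero_right _

/-- The operator obtained from `K` by removing the couplings between `Λ` and its complement. -/
def decouple (K : L2 d →L[ℂ] L2 d) (Λ : Finset (Site d)) : L2 d →L[ℂ] L2 d :=
  proj Λ * K * proj Λ + (1 - proj Λ) * K * (1 - proj Λ)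

theorem isSelfAdjoint_decouple {K : L2 d →L[ℂ] L2 d} (hK : IsSelfAdjoint K)
    (Λ : Finset (Site d)) : IsSelfAdjoint (decouple K Λ) := by
  have hP := (isSelfAdjoint_proj Λ).star_eq
  rw [IsSelfAdjoint, decouple]
  simp only [star_add, star_mul, hP, hK.star_eq, star_sub, star_one, mul_assoc]

theorem isRealOp_decouple {K : L2 d →L[ℂ] L2 d} (hK : IsRealOp K)
    (Λ : Finset (Site d)) : IsRealOp (decouple K Λ) :=
  (((isRealOp_proj Λ).mul hK).mul (isRealOp_proj Λ)).add
    (((isRealOp_one.sub (isRealOp_proj Λ)).mul hK).mul (isRealOp_one.sub (isRealOp_proj Λ)))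

theorem commute_proj_decouple (K : L2 d →L[ℂ] L2 d) (Λ : Finset (Site d)) :
    Commute (proj Λ) (decouple K Λ) := by
  have h1 : proj Λ * (1 - proj Λ) = 0 := by rw [mul_sub, mul_one, proj_mul_proj, sub_self]
  have h2 : (1 - proj Λ) * proj Λ = 0 := by rw [sub_mul, one_mul, proj_mul_proj, sub_self]
  have h3 : proj Λ * decouple K Λ = proj Λ * K * proj Λ := by
    rw [decouple, mul_add, mul_assoc (1 - proj Λ), ← mul_assoc (proj Λ) (1 - proj Λ), h1, zero_mul,
      add_zero, mul_assoc (proj Λ) K, ← mul_assoc, proj_mul_proj]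
  have h4 : decouple K Λ * proj Λ = proj Λ * K * proj Λ := by
    rw [decouple, add_mul, mul_assoc _ (1 - proj Λ), h2, mul_zero,
      add_zero, mul_assoc _ (proj Λ), proj_mul_proj]
  exact h3.trans h4.symm

theorem commute_proj_res {A : L2 d →L[ℂ] L2 d} (hA : IsSelfAdjoint A) {z : ℂ} (hz : z.im ≠ 0)
    {Λ : Finset (Site d)} (h : Commute (proj Λ) A) : Commute (proj Λ) (res A z) := by
  have h1 : Commute (proj Λ) (A - z • 1) :=
    h.sub_right ((Commute.one_right _).smul_right z)
  calc proj Λ * res A z = res A z * ((A - z • 1) * proj Λ) * res A z := by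
        rw [← mul_assoc, res_mul hA hz, one_mul]
    _ = res A z * proj Λ := by
        rw [← h1.eq, mul_assoc, mul_assoc, mul_res hA hz, mul_one]

theorem entry_eq_zero_of_commute {A : L2 d →L[ℂ] L2 d} (hA : IsSelfAdjoint A) {z : ℂ}
    (hz : z.im ≠ 0) {Λ : Finset (Site d)} (h : Commute (proj Λ) A) {x y : Site d}
    (hxy : ¬(x ∈ Λ ↔ y ∈ Λ)) : entry A z x y = 0 := by
  have h1 := congrArg (fun T : L2 d →L[ℂ] L2 d => (T (ket y) : Site d → ℂ) x)
    (commute_proj_res hA hz h).eq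
  simp only [mul_apply_eq_comp, proj_apply_apply, proj_ket] at h1
  rw [entry]
  by_cases hx : x ∈ Λ
  · have hy : y ∉ Λ := by tauto
    simpa [hx, hy] using h1
  · have hy : y ∈ Λ := by tauto
    simpa [hx, hy] using h1.symm

/-- The unit vector `± eᵢ`. -/
def step (j : Fin d × Bool) : Site d := Pi.single j.1 (if j.2 then 1 else -1)

theorem step_injective : Function.Injective (step : Fin d × Bool → Site d) := by
  rintro ⟨i, b⟩ ⟨i', b'⟩ h
  have h1 : i = i' := by
    by_contra hne
    have := congrFun h i
    simp only [step, Pi.single_eq_same, Pi.single_eq_of_ne hne] at this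
    split_ifs at this; simp at this
  subst h1
  have := congrFun h i
  simp only [step, Pi.single_eq_same] at this
  cases b <;> cases b' <;> simp_all

theorem shift_ket (v x : Site d) : shift v (ket x) = ket (x - v) := by
  ext y
  rw [shift_apply, ket_apply, ket_apply]
  simp only [eq_sub_iff_add_eq]

theorem neg_laplacian_ket (u : Site d) :
    (-laplacian d) (ket u) = (2 * d : ℂ) • ket u - ∑ j, ket (u + step j) := by
  simp only [laplacian, neg_apply, sum_apply, sub_apply, add_apply, smul_apply, one_apply_eq_self,
    shift_ket, Fintype.sum_prod_type, Fintype.sum_bool, step, if_true, sub_neg_eq_add]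
  simp only [Finset.sum_sub_distrib, Finset.sum_const, Finset.card_univ, Fintype.card_fin,
    Finset.sum_add_distrib]
  have : ∀ i : Fin d, u - Pi.single i 1 = u + Pi.single i (if (false : Bool) = true then 1 else -1) := by
    intro i
    rw [if_neg (by simp), Pi.single_neg, sub_eq_add_neg]
  simp only [this]
  have h2 : (d • (2 : ℂ) • ket u : L2 d) = (2 * d : ℂ) • ket u := by
    rw [← Nat.cast_smul_eq_nsmul ℂ, smul_smul, mul_comm]
  rw [h2]
  abel

/-- The oriented edges leaving `Λ`. -/
def bdry (Λ : Finset (Site d)) : Finset (Site d × Fin d × Bool) :=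
  (Λ ×ˢ Finset.univ).filter fun e => e.1 + step e.2 ∉ Λ

/-- The outer endpoint of an edge. -/
def outer (e : Site d × Fin d × Bool) : Site d := e.1 + step e.2

theorem fst_mem_of_mem_bdry {Λ : Finset (Site d)} {e : Site d × Fin d × Bool} (he : e ∈ bdry Λ) :
    e.1 ∈ Λ := (Finset.mem_product.1 (Finset.mem_filter.1 he).1).1

theorem outer_notMem_of_mem_bdry {Λ : Finset (Site d)} {e : Site d × Fin d × Bool}
    (he : e ∈ bdry Λ) : outer e ∉ Λ := (Finset.mem_filter.1 he).2

theorem one_sub_proj_mul_neg_laplacian_mul_proj (Λ : Finset (Site d)) :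
    (1 - proj Λ) * (-laplacian d) * proj Λ = -∑ e ∈ bdry Λ, ketbra (outer e) e.1 := by
  refine ContinuousLinearMap.ext fun ψ => ?_
  rw [bdry, Finset.sum_filter, Finset.sum_product, mul_apply_eq_comp, proj_apply, map_sum,
    neg_apply, sum_apply, ← Finset.sum_neg_distrib]
  refine Finset.sum_congr rfl fun u hu => ?_
  rw [map_smul, mul_apply_eq_comp, neg_laplacian_ket, map_sub, map_smul, map_sum, sum_apply]
  have h1 : ∀ w : Site d, (1 - proj Λ) (ket w) = if w ∉ Λ then ket w else 0 := by
    intro w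
    rw [sub_apply, one_apply_eq_self, proj_ket]
    by_cases hw : w ∈ Λ <;> simp [hw]
  simp only [h1, hu, not_true_eq_false, if_false, smul_zero, zero_sub, smul_neg, Finset.smul_sum]
  congr 1
  refine Finset.sum_congr rfl fun j _ => ?_
  by_cases hj : u + step j ∈ Λ
  · simp [hj]
  · simp [hj, ketbra_apply, outer]

theorem proj_mul_neg_laplacian_mul_one_sub_proj (Λ : Finset (Site d)) :
    proj Λ * (-laplacian d) * (1 - proj Λ) = -∑ e ∈ bdry Λ, ketbra e.1 (outer e) := by
  have h := congrArg star (one_sub_proj_mul_neg_laplacian_mul_proj Λ)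
  simp only [star_neg, star_sum, star_ketbra] at h
  rw [← h]
  simp only [star_mul, star_sub, star_one, (isSelfAdjoint_proj Λ).star_eq, star_neg,
    (isSelfAdjoint_laplacian (d := d)).star_eq, mul_assoc]

theorem decouple_sub (Λ : Finset (Site d)) :
    decouple (-laplacian d) Λ - (-laplacian d) =
      ∑ e ∈ bdry Λ, (ketbra e.1 (outer e) + ketbra (outer e) e.1) := by
  have h1 := proj_mul_neg_laplacian_mul_one_sub_proj Λ
  have h2 := one_sub_proj_mul_neg_laplacian_mul_proj Λ
  rw [eq_neg_iff_add_eq_zero, add_comm, ← eq_neg_iff_add_eq_zero] at h1 h2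
  rw [Finset.sum_add_distrib, h1, h2, decouple]
  noncomm_ring

/-- The full operator with the potential `V`. -/
abbrev fullOp (V : Site d → ℝ) : L2 d →L[ℂ] L2 d := -laplacian d + mulOp V

/-- The decoupled operator with the potential `V`. -/
abbrev decOp (Λ : Finset (Site d)) (V : Site d → ℝ) : L2 d →L[ℂ] L2 d :=
  decouple (-laplacian d) Λ + mulOp V

theorem isSelfAdjoint_neg_laplacian : IsSelfAdjoint (-laplacian d) := isSelfAdjoint_laplacian.neg

theorem isSelfAdjoint_fullOp (V : Site d → ℝ) : IsSelfAdjoint (fullOp V) :=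
  isSelfAdjoint_add_mulOp isSelfAdjoint_neg_laplacian V

theorem isSelfAdjoint_decOp (Λ : Finset (Site d)) (V : Site d → ℝ) : IsSelfAdjoint (decOp Λ V) :=
  isSelfAdjoint_add_mulOp (isSelfAdjoint_decouple isSelfAdjoint_neg_laplacian Λ) V

theorem commute_proj_decOp (Λ : Finset (Site d)) (V : Site d → ℝ) :
    Commute (proj Λ) (decOp Λ V) :=
  (commute_proj_decouple _ Λ).add_right (commute_proj_mulOp Λ V)

theorem entry_decOp_eq_zero (Λ : Finset (Site d)) (V : Site d → ℝ) {z : ℂ} (hz : z.im ≠ 0)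
    {x y : Site d} (hxy : ¬(x ∈ Λ ↔ y ∈ Λ)) : entry (decOp Λ V) z x y = 0 :=
  entry_eq_zero_of_commute (isSelfAdjoint_decOp Λ V) hz (commute_proj_decOp Λ V) hxy

/-- In the resolvent identity the decoupled Green function on the right must end outside `Λ`, so
only outward crossings survive, and the uncrossed term vanishes. -/
theorem entry_fullOp_of_mem_of_notMem (Λ : Finset (Site d)) (V : Site d → ℝ) {z : ℂ}
    (hz : z.im ≠ 0) {x y : Site d} (hx : x ∈ Λ) (hy : y ∉ Λ) :
    entry (fullOp V) z x y =
      ∑ e ∈ bdry Λ, entry (fullOp V) z x e.1 * entry (decOp Λ V) z (outer e) y := by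
  have h := entry_sub_entry_eq_sandwich (isSelfAdjoint_fullOp V) (isSelfAdjoint_decOp Λ V) hz x y
  rw [entry_decOp_eq_zero Λ V hz (by tauto), sub_zero, add_sub_add_right_eq_sub, decouple_sub,
    map_sum] at h
  rw [h]
  refine Finset.sum_congr rfl fun e he => ?_
  have := fst_mem_of_mem_bdry he
  rw [map_add, sandwich_ketbra, sandwich_ketbra, entry_decOp_eq_zero Λ V hz (x := e.1) (by tauto),
    mul_zero, add_zero]

/-- The opposite order of factors: the decoupled resolvent now starts at `x` and reaches the
boundary from within, which is where finite-volume decay enters. -/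
theorem entry_fullOp_of_mem (Λ : Finset (Site d)) (V : Site d → ℝ) {z : ℂ}
    (hz : z.im ≠ 0) {x : Site d} (hx : x ∈ Λ) (y : Site d) :
    entry (fullOp V) z x y = entry (decOp Λ V) z x y +
      ∑ e ∈ bdry Λ, entry (decOp Λ V) z x e.1 * entry (fullOp V) z (outer e) y := by
  have h := entry_sub_entry_eq_sandwich (isSelfAdjoint_decOp Λ V) (isSelfAdjoint_fullOp V) hz x y
  rw [add_sub_add_right_eq_sub, ← neg_sub (decouple (-laplacian d) Λ), decouple_sub, map_neg, map_sum] at h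
  rw [← sub_eq_iff_eq_add', ← neg_sub, h, neg_neg]
  refine Finset.sum_congr rfl fun e he => ?_
  have := outer_notMem_of_mem_bdry he
  rw [map_add, sandwich_ketbra, sandwich_ketbra, entry_decOp_eq_zero Λ V hz (y := outer e)
    (by tauto), zero_mul, add_zero]

/-- Changing the potential on `F` while restoring the couplings allows the right-hand factors to be
Green functions of the other potential `U`. This is the source of decorrelation. -/
theorem entry_decOp_of_notMem (Λ F : Finset (Site d)) {U V : Site d → ℝ}
    (hU : BddAbove (Set.range fun x => |U x|)) (hV : BddAbove (Set.range fun x => |V x|))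
    (h : ∀ x, x ∉ F → U x = V x) {z : ℂ}
    (hz : z.im ≠ 0) {x : Site d} (hx : x ∉ Λ) (y : Site d) :
    entry (decOp Λ V) z x y = entry (fullOp U) z x y +
      (∑ w ∈ F, ((U w - V w : ℝ) : ℂ) * (entry (decOp Λ V) z x w * entry (fullOp U) z w y) -
      ∑ e ∈ bdry Λ, entry (decOp Λ V) z x (outer e) * entry (fullOp U) z e.1 y) := by
  have h1 := entry_sub_entry_eq_sandwich (isSelfAdjoint_decOp Λ V) (isSelfAdjoint_fullOp U) hz x y
  have h2 : fullOp U - decOp Λ V = (mulOp U - mulOp V) -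
      (decouple (-laplacian d) Λ - (-laplacian d)) := by
    rw [fullOp, decOp]; abel
  rw [h2, decouple_sub, mulOp_sub_mulOp hU hV h, map_sub, map_sum, map_sum] at h1
  rw [← sub_eq_iff_eq_add', h1]
  congr 1
  · refine Finset.sum_congr rfl fun w _ => ?_
    rw [map_smul, sandwich_ketbra, smul_eq_mul]
  · refine Finset.sum_congr rfl fun e he => ?_
    have := fst_mem_of_mem_bdry he
    rw [map_add, sandwich_ketbra, sandwich_ketbra, entry_decOp_eq_zero Λ V hz (y := e.1)
      (by tauto), zero_mul, zero_add]

/-! ### The finite-volume matrix and the Combes–Thomas estimate -/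

theorem neighbors_add_step (x : Site d) (j : Fin d × Bool) : Neighbors (x + step j) x := by
  rw [Neighbors, Finset.sum_eq_single j.1]
  · rcases j with ⟨i, b⟩
    cases b <;> simp [step]
  · intro i _ hi
    simp [step, Pi.single_eq_of_ne hi]
  · simp

theorem exists_step_of_neighbors {x y : Site d} (h : Neighbors x y) : ∃ j, x = y + step j := by
  rw [Neighbors] at h
  obtain ⟨i, hi⟩ : ∃ i, x i - y i ≠ 0 := by
    by_contra! hc
    simp [hc] at h
  have h1 := Finset.add_sum_erase Finset.univ (fun i => |x i - y i|) (Finset.mem_univ i)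
  rw [h] at h1
  have h2 : 1 ≤ |x i - y i| := Int.one_le_abs hi
  have h3 : 0 ≤ ∑ i ∈ Finset.univ.erase i, |x i - y i| := Finset.sum_nonneg fun _ _ => abs_nonneg _
  have h4 : ∑ i ∈ Finset.univ.erase i, |x i - y i| = 0 := by omega
  rw [Finset.sum_eq_zero_iff_of_nonneg fun _ _ => abs_nonneg _] at h4
  have h5 : |x i - y i| = 1 := by omega
  refine ⟨(i, decide (x i - y i = 1)), ?_⟩
  ext k
  rcases eq_or_ne k i with rfl | hk
  · rcases (abs_eq (by norm_num : (0 : ℤ) ≤ 1)).1 h5 with h6 | h6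
    · simp [step, h6]; omega
    · simp [step, h6]; omega
  · have := h4 k (by simp [hk])
    rw [abs_eq_zero] at this
    simp [step, Pi.single_eq_of_ne hk]; omega

theorem neg_laplacian_ket_apply (x u : Site d) :
    ((-laplacian d) (ket u) : Site d → ℂ) x =
      (if x = u then 2 * (d : ℂ) else 0) - if Neighbors x u then 1 else 0 := by
  rw [neg_laplacian_ket, lp.coeFn_sub, Pi.sub_apply, lp.coeFn_smul, Pi.smul_apply, ket_apply,
    lp.coeFn_sum, Finset.sum_apply]
  simp only [ket_apply]
  congr 1
  · simp
  · by_cases h : Neighbors x u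
    · obtain ⟨j, rfl⟩ := exists_step_of_neighbors h
      simp [h, step_injective.eq_iff]
    · rw [if_neg h]
      refine Finset.sum_eq_zero fun j _ => if_neg ?_
      rintro rfl
      exact h (neighbors_add_step u j)

/-- The matrix elements of the resolvent of the decoupled operator inside `Λ` solve the finite
volume equation. -/
theorem finiteHamiltonian_mulVec_entry (Λ : Finset (Site d)) {V : Site d → ℝ}
    (hV : BddAbove (Set.range fun x => |V x|)) {z : ℂ} (hz : z.im ≠ 0) (x u : Λ) :
    ∑ w : Λ, ((finiteHamiltonian V Λ x w : ℝ) : ℂ) * entry (decOp Λ V) z w u -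
      z * entry (decOp Λ V) z x u = if x = u then 1 else 0 := by
  set φ := res (decOp Λ V) z (ket (u : Site d)) with hφ
  have hPφ : proj Λ φ = φ := by
    have h1 := congrArg (fun T : L2 d →L[ℂ] L2 d => T (ket (u : Site d)))
      (commute_proj_res (isSelfAdjoint_decOp Λ V) hz (commute_proj_decOp Λ V)).eq
    simp only [mul_apply_eq_comp, proj_ket, u.2, if_true] at h1
    exact h1
  have h2 : (decOp Λ V - z • (1 : L2 d →L[ℂ] L2 d)) φ = ket (u : Site d) := by
    rw [hφ, ← mul_apply_eq_comp, mul_res (isSelfAdjoint_decOp Λ V) hz]; rfl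
  have h3 := congrArg (fun ψ : L2 d => (ψ : Site d → ℂ) x) h2
  simp only [sub_apply, smul_apply, one_apply_eq_self, lp.coeFn_sub, lp.coeFn_smul, Pi.sub_apply,
    Pi.smul_apply, smul_eq_mul, ket_apply, add_apply, lp.coeFn_add, Pi.add_apply,
    mulOp_apply hV] at h3
  have h4 : (decouple (-laplacian d) Λ φ : Site d → ℂ) x =
      ∑ w : Λ, ((if (x : Site d) = w then 2 * (d : ℂ) else 0) -
        if Neighbors (x : Site d) (w : Site d) then 1 else 0) * (φ : Site d → ℂ) w := by
    have h5 : decouple (-laplacian d) Λ φ = proj Λ ((-laplacian d) φ) := by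
      simp only [decouple, add_apply, mul_apply_eq_comp, sub_apply, one_apply_eq_self, hPφ,
        sub_self, map_zero, add_zero]
    rw [h5, proj_apply_apply, if_pos x.2]
    conv_lhs => rw [← hPφ, proj_apply]
    rw [map_sum, lp.coeFn_sum, Finset.sum_apply, ← Finset.sum_coe_sort]
    refine Finset.sum_congr rfl fun w _ => ?_
    rw [map_smul, lp.coeFn_smul, Pi.smul_apply, neg_laplacian_ket_apply, smul_eq_mul, mul_comm]
  have h6 : ∑ w : Λ, ((finiteHamiltonian V Λ x w : ℝ) : ℂ) * entry (decOp Λ V) z w u =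
      (decouple (-laplacian d) Λ φ : Site d → ℂ) x + V x * (φ : Site d → ℂ) x := by
    rw [h4]
    have h7 : (V x : ℂ) * (φ : Site d → ℂ) x =
        ∑ w : Λ, if x = w then (V x : ℂ) * (φ : Site d → ℂ) w else 0 := by simp
    rw [h7, ← Finset.sum_add_distrib]
    refine Finset.sum_congr rfl fun w _ => ?_
    change _ * (φ : Site d → ℂ) w = _
    rw [finiteHamiltonian, Matrix.of_apply]
    by_cases hxw : x = w
    · subst hxw
      have : ¬Neighbors (x : Site d) (x : Site d) := by simp [Neighbors]
      simp only [if_true, this, if_false]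
      push_cast; ring
    · have hxw' : (x : Site d) ≠ w := fun h => hxw (Subtype.ext h)
      simp only [hxw, hxw', if_false]
      split_ifs <;> simp
  rw [h6]
  change _ - z * (φ : Site d → ℂ) x = _
  rw [h3]
  simp only [Subtype.ext_iff]

open Matrix in
/-- A real symmetric matrix whose spectrum has distance at least `δ` from `Re z` satisfies
`δ ‖f‖ ≤ ‖(A - z) f‖`. -/
theorem le_norm_mulVec_sub_smul {n : Type*} [Fintype n] [DecidableEq n] {A : Matrix n n ℝ}
    (hA : A.IsSymm) {z : ℂ} {δ : ℝ} (hδ : 0 ≤ δ) (h : ∀ t ∈ spectrum ℝ A, δ ≤ |t - z.re|)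
    (f : n → ℂ) :
    δ * ‖WithLp.toLp 2 f‖ ≤ ‖WithLp.toLp 2 (A.map (fun t : ℝ => (t : ℂ)) *ᵥ f - z • f)‖ := by
  set B : Matrix n n ℂ := A.map (fun t : ℝ => (t : ℂ)) with hB
  have hBH : B.IsHermitian := by
    ext i j
    simp [hB, hA.apply i j]
  set e := hBH.eigenvectorBasis
  -- Complexification is an algebra homomorphism, so it creates no new real spectral points.
  have hspec : ∀ i, hBH.eigenvalues i ∈ spectrum ℝ A := by
    intro i
    have h1 := hBH.eigenvalues_mem_spectrum_real i
    exact AlgHom.spectrum_apply_subset (Complex.ofRealAm.mapMatrix) A h1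
  have hin : ∀ i, inner ℂ (e i) (WithLp.toLp 2 (B *ᵥ f)) =
      (hBH.eigenvalues i : ℂ) * inner ℂ (e i) (WithLp.toLp 2 f) := by
    intro i
    rw [EuclideanSpace.inner_eq_star_dotProduct, EuclideanSpace.inner_eq_star_dotProduct]
    simp only
    rw [dotProduct_comm, dotProduct_mulVec]
    have h1 : star (WithLp.ofLp (e i)) ᵥ* B = star (B *ᵥ WithLp.ofLp (e i)) := by
      rw [star_mulVec, hBH.eq]
    rw [h1, hBH.mulVec_eigenvectorBasis, star_smul, smul_dotProduct, dotProduct_comm]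
    rw [Complex.real_smul, star_trivial]
  have hsq : (δ * ‖WithLp.toLp 2 f‖) ^ 2 ≤ ‖WithLp.toLp 2 (B *ᵥ f - z • f)‖ ^ 2 := by
    rw [mul_pow, ← e.sum_sq_norm_inner_right, ← e.sum_sq_norm_inner_right, Finset.mul_sum]
    refine Finset.sum_le_sum fun i _ => ?_
    rw [WithLp.toLp_sub, WithLp.toLp_smul, inner_sub_right, inner_smul_right, hin, ← sub_mul,
      norm_mul, mul_pow]
    gcongr
    refine (h _ (hspec i)).trans ?_
    have := Complex.abs_re_le_norm ((hBH.eigenvalues i : ℂ) - z)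
    simpa using this
  exact le_of_sq_le_sq hsq (norm_nonneg _)

theorem neighbors_comm {x y : Site d} : Neighbors x y ↔ Neighbors y x := by
  rw [Neighbors, Neighbors]
  simp only [abs_sub_comm]

theorem isSymm_finiteHamiltonian (V : Site d → ℝ) (Λ : Finset (Site d)) :
    (finiteHamiltonian V Λ).IsSymm := by
  ext x y
  simp only [finiteHamiltonian, Matrix.transpose_apply, Matrix.of_apply]
  by_cases h : x = y
  · subst h; rfl
  · rw [if_neg h, if_neg (Ne.symm h)]
    simp only [neighbors_comm]

theorem card_neighbors_le (Λ : Finset (Site d)) (x : Λ) :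
    (Finset.univ.filter fun w : Λ => Neighbors (x : Site d) (w : Site d)).card ≤ 2 * d := by
  classical
  have h : (Finset.univ.filter fun w : Λ => Neighbors (x : Site d) (w : Site d)).card ≤
      (Finset.univ.image fun j : Fin d × Bool => (x : Site d) + step j).card := by
    refine Finset.card_le_card_of_injOn (fun w => (w : Site d)) ?_ Subtype.val_injective.injOn
    intro w hw
    simp only [Finset.coe_filter, Finset.mem_univ, true_and, Set.mem_ofPred_eq] at hw
    obtain ⟨j, hj⟩ := exists_step_of_neighbors (neighbors_comm.1 hw)
    simp only [Finset.coe_image, Finset.coe_univ, Set.image_univ, Set.mem_range]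
    exact ⟨j, hj.symm⟩
  refine h.trans (Finset.card_image_le.trans ?_)
  simp [mul_comm]

/-- A Schur test: Cauchy–Schwarz over at most 2d neighbours, then symmetry of the neighbour relation
to exchange the sums. -/
theorem sum_sq_sum_neighbors_le (Λ : Finset (Site d)) (f : Λ → ℝ) :
    ∑ x : Λ, (∑ w ∈ Finset.univ.filter fun w : Λ => Neighbors (x : Site d) (w : Site d), f w) ^ 2 ≤
      (2 * d) ^ 2 * ∑ w, f w ^ 2 := by
  calc _ ≤ ∑ x : Λ, (2 * d : ℝ) *
        ∑ w ∈ Finset.univ.filter fun w : Λ => Neighbors (x : Site d) (w : Site d), f w ^ 2 := by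
        refine Finset.sum_le_sum fun x _ => sq_sum_le_card_mul_sum_sq.trans ?_
        gcongr
        · exact_mod_cast card_neighbors_le Λ x
    _ = (2 * d : ℝ) * ∑ w : Λ, ∑ x ∈ Finset.univ.filter fun x : Λ =>
          Neighbors (w : Site d) (x : Site d), f w ^ 2 := by
        rw [← Finset.mul_sum]
        congr 1
        simp only [Finset.sum_filter]
        rw [Finset.sum_comm]
        simp only [neighbors_comm]
    _ ≤ (2 * d : ℝ) * ∑ w : Λ, (2 * d) * f w ^ 2 := by
        gcongr with w _
        rw [Finset.sum_const, nsmul_eq_mul]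
        gcongr
        exact_mod_cast card_neighbors_le Λ w
    _ = _ := by rw [← Finset.mul_sum]; ring

/-- The Combes–Thomas estimate for the finite volume resolvent, with a weight function `ψ` that
varies by at most one between neighbours. -/
theorem norm_le_of_finiteHamiltonian_solution (hd : 1 ≤ d) (Λ : Finset (Site d)) (V : Site d → ℝ)
    {z : ℂ} {δ : ℝ} (hδ0 : 0 < δ) (hδ1 : δ ≤ 1)
    (h : ∀ t ∈ spectrum ℝ (finiteHamiltonian V Λ), δ ≤ |t - z.re|) (ψ : Site d → ℝ)
    (hψ : ∀ x y, Neighbors x y → |ψ x - ψ y| ≤ 1) (c : Λ → ℂ) (u : Λ)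
    (hc : ∀ x : Λ, ∑ w : Λ, ((finiteHamiltonian V Λ x w : ℝ) : ℂ) * c w - z * c x =
      if x = u then 1 else 0) (x : Λ) :
    ‖c x‖ ≤ 2 / δ * Real.exp (δ / (8 * d) * (ψ u - ψ x)) := by
  have hd' : (1 : ℝ) ≤ d := by exact_mod_cast hd
  -- This rate makes the commutator bound 4dκ equal to δ/2, half of the spectral gap.
  set κ : ℝ := δ / (8 * d) with hκ
  have hκ0 : 0 < κ := by positivity
  have hκδ : 4 * d * κ = δ / 2 := by rw [hκ]; field_simp; norm_num
  have hκ1 : κ ≤ 1 := by nlinarith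
  set a : Λ → ℝ := fun x => Real.exp (κ * ψ x) with ha
  have ha0 : ∀ x, 0 < a x := fun x => Real.exp_pos _
  set f : Λ → ℂ := fun x => a x * c x with hf
  -- The commutator of the matrix with the weight `a`, applied to `c`; the diagonal, hence the
  -- potential, drops out of it.
  set r : Λ → ℂ := fun x =>
    ∑ w : Λ, ((finiteHamiltonian V Λ x w : ℝ) : ℂ) * ((a w - a x : ℝ) : ℂ) * c w with hr
  have hg : Matrix.mulVec ((finiteHamiltonian V Λ).map (fun t : ℝ => (t : ℂ))) f - z • f =
      Pi.single u (a u : ℂ) + r := by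
    ext x
    simp only [Pi.sub_apply, Pi.add_apply, Pi.smul_apply, smul_eq_mul, Matrix.mulVec, dotProduct,
      Matrix.map_apply]
    have h1 : (Pi.single u (a u : ℂ) : Λ → ℂ) x = a x * if x = u then 1 else 0 := by
      by_cases hx : x = u
      · subst hx; simp
      · simp [hx]
    rw [h1, ← hc x, mul_sub, Finset.mul_sum, hr, hf]
    simp only
    rw [sub_add_eq_add_sub, ← Finset.sum_add_distrib]
    congr 1
    · refine Finset.sum_congr rfl fun w _ => ?_
      push_cast; ring
    · ring
  have hlow := le_norm_mulVec_sub_smul (isSymm_finiteHamiltonian V Λ) hδ0.le h f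
  rw [hg, WithLp.toLp_add] at hlow
  have hrx : ∀ x, ‖r x‖ ≤ 2 * κ *
      ∑ w ∈ Finset.univ.filter fun w : Λ => Neighbors (x : Site d) (w : Site d), ‖f w‖ := by
    intro x
    rw [Finset.mul_sum, Finset.sum_filter]
    refine (norm_sum_le _ _).trans (Finset.sum_le_sum fun w _ => ?_)
    rw [finiteHamiltonian, Matrix.of_apply]
    by_cases hxw : x = w
    · subst hxw; simp [Neighbors]
    rw [if_neg hxw]
    by_cases hN : Neighbors (x : Site d) (w : Site d)
    · rw [if_pos hN, if_pos hN, hf]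
      simp only [norm_mul, Complex.norm_real, Real.norm_eq_abs, abs_neg, abs_one, one_mul,
        abs_of_pos (ha0 w)]
      rw [← mul_assoc]
      gcongr
      have h1 : a w - a x = -(a w * (Real.exp (κ * (ψ x - ψ w)) - 1)) := by
        rw [ha, mul_sub]
        simp only
        rw [← Real.exp_add, mul_one, show κ * ψ w + κ * (ψ x - ψ w) = κ * ψ x by ring]
        ring
      rw [h1, abs_neg, abs_mul, abs_of_pos (ha0 w), mul_comm]
      gcongr
      have h2 : |κ * (ψ x - ψ w)| ≤ κ := by
        rw [abs_mul, abs_of_pos hκ0]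
        exact mul_le_of_le_one_right hκ0.le (hψ _ _ hN)
      exact (Real.abs_exp_sub_one_le (h2.trans hκ1)).trans (by linarith)
    · rw [if_neg hN, if_neg hN]; simp
  have hrn : ‖WithLp.toLp 2 r‖ ≤ 4 * d * κ * ‖WithLp.toLp 2 f‖ := by
    refine le_of_sq_le_sq ?_ (by positivity)
    rw [mul_pow, EuclideanSpace.norm_sq_eq, EuclideanSpace.norm_sq_eq]
    simp only
    calc ∑ x, ‖r x‖ ^ 2 ≤ ∑ x : Λ, (2 * κ * ∑ w ∈ Finset.univ.filter fun w : Λ =>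
          Neighbors (x : Site d) (w : Site d), ‖f w‖) ^ 2 := by
          gcongr with x _
          exact hrx x
      _ = (2 * κ) ^ 2 * ∑ x : Λ, (∑ w ∈ Finset.univ.filter fun w : Λ =>
          Neighbors (x : Site d) (w : Site d), ‖f w‖) ^ 2 := by
          rw [Finset.mul_sum]; simp only [mul_pow]
      _ ≤ (2 * κ) ^ 2 * ((2 * d) ^ 2 * ∑ w, ‖f w‖ ^ 2) := by
          gcongr
          exact sum_sq_sum_neighbors_le Λ fun w => ‖f w‖
      _ = _ := by ring
  have hs : ‖WithLp.toLp 2 (Pi.single u (a u : ℂ) : Λ → ℂ)‖ = a u := by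
    have : WithLp.toLp 2 (Pi.single u (a u : ℂ) : Λ → ℂ) = EuclideanSpace.single u (a u : ℂ) := rfl
    rw [this, PiLp.norm_single, Complex.norm_real, Real.norm_eq_abs, abs_of_pos (ha0 u)]
  -- From δ‖f‖ ≤ a(u) + (δ/2)‖f‖, the last term is absorbed on the left.
  have hfn : ‖WithLp.toLp 2 f‖ ≤ 2 / δ * a u := by
    have h1 := hlow.trans (norm_add_le _ _)
    rw [hs] at h1
    rw [hκδ] at hrn
    rw [div_mul_eq_mul_div, le_div_iff₀ hδ0]
    nlinarith
  have hfx : a x * ‖c x‖ ≤ 2 / δ * a u := by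
    have h1 := PiLp.norm_apply_le (WithLp.toLp 2 f) x
    simp only [hf, norm_mul, Complex.norm_real, Real.norm_eq_abs, abs_of_pos (ha0 x)] at h1
    exact h1.trans hfn
  have hau : a u = a x * Real.exp (κ * (ψ u - ψ x)) := by
    rw [ha]
    simp only
    rw [← Real.exp_add]; congr 1; ring
  rw [hau] at hfx
  refine le_of_mul_le_mul_left ?_ (ha0 x)
  linarith

/-! ### Hölder estimates for products of fractional moments -/

theorem enorm_sum_rpow_le {ι : Type*} (I : Finset ι) (a : ι → ℂ) {s : ℝ} (hs0 : 0 < s)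
    (hs1 : s ≤ 1) : ‖∑ i ∈ I, a i‖ₑ ^ s ≤ ∑ i ∈ I, ‖a i‖ₑ ^ s := by
  classical
  induction I using Finset.induction_on with
  | empty => simp [hs0]
  | insert i I hi ih =>
    rw [Finset.sum_insert hi, Finset.sum_insert hi]
    calc _ ≤ (‖a i‖ₑ + ‖∑ i ∈ I, a i‖ₑ) ^ s := by gcongr; exact enorm_add_le _ _
      _ ≤ ‖a i‖ₑ ^ s + ‖∑ i ∈ I, a i‖ₑ ^ s := ENNReal.rpow_add_le_add_rpow _ _ hs0.le hs1
      _ ≤ _ := by gcongr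

theorem enorm_add_rpow_le (a b : ℂ) {s : ℝ} (hs0 : 0 < s) (hs1 : s ≤ 1) :
    ‖a + b‖ₑ ^ s ≤ ‖a‖ₑ ^ s + ‖b‖ₑ ^ s :=
  calc _ ≤ (‖a‖ₑ + ‖b‖ₑ) ^ s := by gcongr; exact enorm_add_le _ _
    _ ≤ _ := ENNReal.rpow_add_le_add_rpow _ _ hs0.le hs1

theorem enorm_mul_rpow (a b : ℂ) {s : ℝ} (hs0 : 0 ≤ s) : ‖a * b‖ₑ ^ s = ‖a‖ₑ ^ s * ‖b‖ₑ ^ s := by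
  rw [enorm_mul, ENNReal.mul_rpow_of_nonneg _ _ hs0]

/-- Hölder with weight 1 - 3r on the constant 1 and weight r on each of the three functions; `1 ≤ C`
replaces C^{3r} by C. -/
theorem setLIntegral_mul_mul_le {α : Type*} [MeasurableSpace α] {P : Measure α}
    {X Y Z : α → ℝ≥0∞} (hX : Measurable X) (hY : Measurable Y) (hZ : Measurable Z)
    {B : Set α} {C : ℝ≥0∞} (hC : 1 ≤ C) {r : ℝ} (hr0 : 0 < r)
    (hr1 : 3 * r < 1) (hXC : ∫⁻ a, X a ∂P ≤ C) (hYC : ∫⁻ a, Y a ∂P ≤ C) (hZC : ∫⁻ a, Z a ∂P ≤ C) :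
    ∫⁻ a in B, X a ^ r * Y a ^ r * Z a ^ r ∂P ≤ P B ^ (1 - 3 * r) * C := by
  have h := ENNReal.lintegral_prod_norm_pow_le (μ := P.restrict B) (Finset.univ : Finset (Fin 4))
    (f := ![fun _ => 1, X, Y, Z]) (p := ![1 - 3 * r, r, r, r]) (by
      intro i _
      fin_cases i
      · exact aemeasurable_const
      · exact hX.aemeasurable
      · exact hY.aemeasurable
      · exact hZ.aemeasurable) (by simp [Fin.sum_univ_four]; ring) (by
      intro i _
      fin_cases i
      · simp; linarith
      · simpa using hr0.le
      · simpa using hr0.le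
      · simpa using hr0.le)
  simp only [Fin.prod_univ_four, Matrix.cons_val_zero, Matrix.cons_val_one, Matrix.cons_val,
    ENNReal.one_rpow, one_mul, lintegral_const, Measure.restrict_apply MeasurableSet.univ,
    Set.univ_inter] at h
  refine h.trans ?_
  have hle : ∀ {X : α → ℝ≥0∞}, ∫⁻ a, X a ∂P ≤ C → ∫⁻ a in B, X a ∂P ≤ C := fun hX =>
    (setLIntegral_le_lintegral _ _).trans hX
  calc _ ≤ P B ^ (1 - 3 * r) * C ^ r * C ^ r * C ^ r := by
        gcongr
        · exact hle hXC
        · exact hle hYC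
        · exact hle hZC
    _ = P B ^ (1 - 3 * r) * C ^ (3 * r) := by
        rw [mul_assoc, mul_assoc, ← ENNReal.rpow_add_of_nonneg _ _ hr0.le hr0.le,
          ← ENNReal.rpow_add_of_nonneg _ _ hr0.le (by linarith)]
        congr 2; ring
    _ ≤ P B ^ (1 - 3 * r) * C ^ (1 : ℝ) := by
        gcongr
    _ = _ := by rw [ENNReal.rpow_one]

/-- Hölder's inequality for a product of three moments, the first factor of which is small off
an event `B` of small probability. -/
theorem lintegral_mul_mul_le_of_compl {α : Type*} [MeasurableSpace α] {P : Measure α}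
    [IsProbabilityMeasure P]
    {X Y Z : α → ℝ≥0∞} (hX : Measurable X) (hY : Measurable Y) (hZ : Measurable Z)
    {B : Set α} (hB : MeasurableSet B) {C : ℝ≥0∞} (hC : 1 ≤ C) {r : ℝ} (hr0 : 0 < r)
    (hr1 : 3 * r < 1) (hXC : ∫⁻ a, X a ∂P ≤ C) (hYC : ∫⁻ a, Y a ∂P ≤ C) (hZC : ∫⁻ a, Z a ∂P ≤ C)
    {ε : ℝ≥0∞} (hε : ∀ a ∉ B, X a ^ r ≤ ε) :
    ∫⁻ a, X a ^ r * Y a ^ r * Z a ^ r ∂P ≤ (ε + P B ^ (1 - 3 * r)) * C := by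
  rw [← lintegral_add_compl _ hB, add_comm, add_mul]
  gcongr
  · calc _ ≤ ∫⁻ a in Bᶜ, ε * (1 ^ r * Y a ^ r * Z a ^ r) ∂P := by
          refine setLIntegral_mono' hB.compl fun a ha => ?_
          rw [ENNReal.one_rpow, one_mul, mul_assoc]
          gcongr
          exact hε a ha
      _ = ε * ∫⁻ a in Bᶜ, 1 ^ r * Y a ^ r * Z a ^ r ∂P := by
          rw [lintegral_const_mul _ (by fun_prop)]
      _ ≤ ε * (P Bᶜ ^ (1 - 3 * r) * C) := by
          gcongr
          exact setLIntegral_mul_mul_le (X := fun _ => 1) measurable_const hY hZ hC hr0 hr1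
            (by simpa using hC) hYC hZC
      _ ≤ ε * C := by
          gcongr
          refine mul_le_of_le_one_left' ?_
          exact ENNReal.rpow_le_one prob_le_one (by linarith)
  · exact setLIntegral_mul_mul_le hX hY hZ hC hr0 hr1 hXC hYC hZC

theorem lintegral_sum_mul_sum_le {α ι κ : Type*} [MeasurableSpace α] {P : Measure α}
    (I : Finset ι) (J : Finset κ) {X : ι → α → ℝ≥0∞} {Z : κ → α → ℝ≥0∞} (F : κ → ℝ≥0∞)
    (hX : ∀ i ∈ I, Measurable (X i)) (hZ : ∀ j ∈ J, Measurable (Z j)) {k : ℝ≥0∞}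
    (h : ∀ i ∈ I, ∀ j ∈ J, ∫⁻ a, X i a * Z j a ∂P ≤ k) :
    ∫⁻ a, (∑ i ∈ I, X i a) * (∑ j ∈ J, Z j a * F j) ∂P ≤ I.card * k * ∑ j ∈ J, F j := by
  calc _ = ∫⁻ a, ∑ i ∈ I, ∑ j ∈ J, (X i a * Z j a) * F j ∂P := by
        refine lintegral_congr fun a => ?_
        rw [Finset.sum_mul_sum]
        refine Finset.sum_congr rfl fun i _ => Finset.sum_congr rfl fun j _ => (mul_assoc _ _ _).symm
    _ = ∑ i ∈ I, ∑ j ∈ J, (∫⁻ a, X i a * Z j a ∂P) * F j := by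
        have hm : ∀ i ∈ I, ∀ j ∈ J, AEMeasurable (fun a => X i a * Z j a * F j) P :=
          fun i hi j hj => (((hX i hi).mul (hZ j hj)).mul_const (F j)).aemeasurable
        rw [lintegral_finsetSum' _ fun i hi => Finset.aemeasurable_fun_sum _ (hm i hi)]
        refine Finset.sum_congr rfl fun i hi => ?_
        rw [lintegral_finsetSum' _ (hm i hi)]
        refine Finset.sum_congr rfl fun j hj => ?_
        exact lintegral_mul_const _ ((hX i hi).mul (hZ j hj))
    _ ≤ ∑ i ∈ I, ∑ j ∈ J, k * F j := by
        gcongr with i hi j hj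
        exact h i hi j hj
    _ = _ := by
        rw [Finset.sum_const, nsmul_eq_mul, ← Finset.mul_sum, mul_assoc]

/-! ### One step of the finite-volume criterion -/

/-- The region `Λ` together with the outer endpoints of its boundary edges. -/
def enlarge (Λ : Finset (Site d)) : Finset (Site d) :=
  open Classical in Λ ∪ (bdry Λ).image outer

theorem subset_enlarge (Λ : Finset (Site d)) : Λ ⊆ enlarge Λ := Finset.subset_union_left

theorem outer_mem_enlarge {Λ : Finset (Site d)} {e : Site d × Fin d × Bool} (he : e ∈ bdry Λ) :
    outer e ∈ enlarge Λ := by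
  classical
  exact Finset.mem_union_right _ (Finset.mem_image_of_mem _ he)

theorem abs_clamp_sub_clamp_le {M : ℝ} (hM : 0 ≤ M) (V W : Site d → ℝ) (x : Site d) :
    |clamp M V x - clamp M W x| ≤ 2 * M := by
  have h1 := abs_le.1 (abs_clamp_le hM V x)
  have h2 := abs_le.1 (abs_clamp_le hM W x)
  rw [abs_le]
  constructor <;> linarith [h1.1, h1.2, h2.1, h2.2]

/-- The Green functions ending at `y` on the right do not involve `W`, so they factor out of the
integral over `W`. The price is a boundary sum and the bound `2 * M` on changes of the potential. -/
theorem enorm_entry_decOp_rpow_le {M : ℝ} (hM : 0 ≤ M) {s : ℝ} (hs0 : 0 < s) (hs1 : s ≤ 1) {z : ℂ}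
    (hz : z.im ≠ 0) (Λ : Finset (Site d)) (W V : Site d → ℝ) {x : Site d} (hx : x ∉ Λ)
    (y : Site d) :
    ‖entry (decOp Λ (clamp M (mix (enlarge Λ) W V))) z x y‖ₑ ^ s ≤
      ‖entry (fullOp (clamp M V)) z x y‖ₑ ^ s + ∑ e ∈ bdry Λ,
        ‖entry (decOp Λ (clamp M (mix (enlarge Λ) W V))) z x (outer e)‖ₑ ^ s *
        (ENNReal.ofReal (2 * M) ^ s * ‖entry (fullOp (clamp M V)) z (outer e) y‖ₑ ^ s +
          ‖entry (fullOp (clamp M V)) z e.1 y‖ₑ ^ s) := by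
  classical
  set v := clamp M (mix (enlarge Λ) W V) with hv
  set u := clamp M V with hu
  have hvu : ∀ w, w ∉ enlarge Λ → u w = v w := by
    intro w hw
    rw [hu, hv, clamp, clamp, mix_of_notMem (by simpa using hw)]
  have h := entry_decOp_of_notMem Λ (enlarge Λ) (bddAbove_clamp hM V) (bddAbove_clamp hM _) hvu hz
    hx y
  rw [← hu, ← hv] at h
  -- Changes of the potential inside `Λ` are invisible to the decoupled resolvent started outside;
  -- only the outer endpoints contribute.
  have hsum : ∑ w ∈ enlarge Λ, ((u w - v w : ℝ) : ℂ) *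
      (entry (decOp Λ v) z x w * entry (fullOp u) z w y) =
      ∑ w ∈ (bdry Λ).image outer, ((u w - v w : ℝ) : ℂ) *
      (entry (decOp Λ v) z x w * entry (fullOp u) z w y) := by
    symm
    refine Finset.sum_subset Finset.subset_union_right fun w hw hw' => ?_
    have : w ∈ Λ := (Finset.mem_union.1 hw).resolve_right hw'
    rw [entry_decOp_eq_zero Λ v hz (y := w) (by tauto)]
    simp
  rw [hsum] at h
  rw [h]
  refine (enorm_add_rpow_le _ _ hs0 hs1).trans ?_
  gcongr
  rw [sub_eq_add_neg]
  refine (enorm_add_rpow_le _ _ hs0 hs1).trans ?_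
  rw [enorm_neg]
  simp only [mul_add]
  rw [Finset.sum_add_distrib]
  gcongr
  · refine (enorm_sum_rpow_le _ _ hs0 hs1).trans ?_
    refine (Finset.sum_image_le_of_nonneg ?_).trans ?_
    · intro w _; exact zero_le
    refine Finset.sum_le_sum fun e _ => ?_
    rw [enorm_mul_rpow _ _ hs0.le, enorm_mul_rpow _ _ hs0.le, ← mul_assoc, ← mul_assoc,
      mul_comm (‖((u (outer e) - v (outer e) : ℝ) : ℂ)‖ₑ ^ s)]
    gcongr
    rw [← ofReal_norm, Complex.norm_real, Real.norm_eq_abs]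
    exact ENNReal.ofReal_le_ofReal (abs_clamp_sub_clamp_le hM _ _ _)
  · refine (enorm_sum_rpow_le _ _ hs0 hs1).trans (Finset.sum_le_sum fun e _ => ?_)
    rw [enorm_mul_rpow _ _ hs0.le]

theorem enorm_entry_fullOp_rpow_le {s : ℝ} (hs0 : 0 < s) (hs1 : s ≤ 1) {z : ℂ}
    (hz : z.im ≠ 0) (Λ : Finset (Site d)) (V : Site d → ℝ) {x y : Site d} (hx : x ∈ Λ)
    (hy : y ∉ Λ) :
    ‖entry (fullOp V) z x y‖ₑ ^ s ≤ ∑ e ∈ bdry Λ,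
      (‖entry (decOp Λ V) z x e.1‖ₑ ^ s + ∑ e' ∈ bdry Λ,
        ‖entry (decOp Λ V) z x e'.1‖ₑ ^ s * ‖entry (fullOp V) z (outer e') e.1‖ₑ ^ s) *
      ‖entry (decOp Λ V) z (outer e) y‖ₑ ^ s := by
  rw [entry_fullOp_of_mem_of_notMem Λ V hz hx hy]
  refine (enorm_sum_rpow_le _ _ hs0 hs1).trans (Finset.sum_le_sum fun e _ => ?_)
  rw [enorm_mul_rpow _ _ hs0.le]
  gcongr
  rw [entry_fullOp_of_mem Λ V hz hx]
  refine (enorm_add_rpow_le _ _ hs0 hs1).trans ?_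
  gcongr
  refine (enorm_sum_rpow_le _ _ hs0 hs1).trans (Finset.sum_le_sum fun e _ => ?_)
  rw [enorm_mul_rpow _ _ hs0.le]

theorem measurable_entry_mix {M : ℝ} (hM : 0 ≤ M) {K : L2 d →L[ℂ] L2 d} (hK : IsSelfAdjoint K)
    {z : ℂ} (hz : z.im ≠ 0) (F : Set (Site d)) (V : Site d → ℝ) (x y : Site d) :
    Measurable fun W : Site d → ℝ => entry (K + mulOp (clamp M (mix F W V))) z x y :=
  (measurable_entry hM hK hz x y).comp
    ((measurable_mix F).comp (measurable_id.prodMk measurable_const))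

/-- `C` bounds the square root moments of all Green functions, given the potential off `F`. -/
def IsMomentBound (d : ℕ) (M : ℝ) (ν : Measure ℝ) [IsProbabilityMeasure ν] (C : ℝ≥0∞) : Prop :=
  1 ≤ C ∧ ∀ K : L2 d →L[ℂ] L2 d, IsSelfAdjoint K → IsRealOp K → ∀ z : ℂ, z.im ≠ 0 →
    ∀ (F : Set (Site d)) (V : Site d → ℝ) (x y : Site d), x ∈ F → y ∈ F →
    ∫⁻ W, ‖entry (K + mulOp (clamp M (mix F W V))) z x y‖ₑ ^ (1 / 2 : ℝ) ∂iidLaw d ν ≤ C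

/-- The finite volume criterion in one step: if the finite volume Green function is small off an
event of small probability, then the moments of the full Green function contract. -/
theorem lintegral_entry_fullOp_le {M : ℝ} {ν : Measure ℝ} [IsProbabilityMeasure ν]
    (hM : 0 ≤ M) {C : ℝ≥0∞} (hC : IsMomentBound d M ν C) {s : ℝ} (hs0 : 0 < s)
    (hs1 : 6 * s < 1) {z : ℂ} (hz : z.im ≠ 0) (Λ : Finset (Site d)) {x y : Site d} (hx : x ∈ Λ)
    (hy : y ∉ Λ) {B : Set (Site d → ℝ)} (hB : MeasurableSet B)
    (hBmix : ∀ W V, mix (enlarge Λ) W V ∈ B → W ∈ B) {ε τ : ℝ≥0∞}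
    (hε : ∀ V ∉ B, ∀ e ∈ bdry Λ, ‖entry (decOp Λ (clamp M V)) z x e.1‖ₑ ^ s ≤ ε)
    (hτ : ∀ w ∈ enlarge Λ, ∫⁻ V, ‖entry (fullOp (clamp M V)) z w y‖ₑ ^ s ∂iidLaw d ν ≤ τ) :
    ∫⁻ V, ‖entry (fullOp (clamp M V)) z x y‖ₑ ^ s ∂iidLaw d ν ≤
      ((bdry Λ).card : ℝ≥0∞) * (((bdry Λ).card + 1) * ((ε + iidLaw d ν B ^ (1 - 6 * s)) * C) *
        (1 + (bdry Λ).card * (ENNReal.ofReal (2 * M) ^ s + 1))) * τ := by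
  set P := iidLaw d ν with hP
  set N : ℝ≥0∞ := ((bdry Λ).card : ℝ≥0∞) with hN
  set k : ℝ≥0∞ := (ε + P B ^ (1 - 6 * s)) * C with hk
  set m : ℝ≥0∞ := ENNReal.ofReal (2 * M) ^ s with hm
  set E : Set (Site d) := (enlarge Λ : Set (Site d)) with hE
  have hs1' : s ≤ 1 := by linarith
  have hKd : IsSelfAdjoint (decouple (-laplacian d) Λ) :=
    isSelfAdjoint_decouple isSelfAdjoint_neg_laplacian Λ
  have hKdR : IsRealOp (decouple (-laplacian d) Λ) := isRealOp_decouple isRealOp_neg_laplacian Λ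
  -- Each s-moment is the power 2s of a half moment; three such factors use up 6s of the Hölder
  -- weight.
  have hhalf : ∀ a : ℂ, ‖a‖ₑ ^ s = (‖a‖ₑ ^ (1 / 2 : ℝ)) ^ (2 * s) := by
    intro a
    rw [← ENNReal.rpow_mul]; congr 1; ring
  have hmeasF : ∀ w : Site d, Measurable fun V : Site d → ℝ =>
      ‖entry (fullOp (clamp M V)) z w y‖ₑ ^ s := fun w =>
    ((measurable_entry hM isSelfAdjoint_neg_laplacian hz w y).enorm).pow_const s
  rw [← lintegral_mix ν E (hmeasF x)]
  set F : (Site d → ℝ) → Site d → ℝ≥0∞ := fun V w => ‖entry (fullOp (clamp M V)) z w y‖ₑ ^ s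
    with hF
  have inner : ∀ V : Site d → ℝ, ∫⁻ W, ‖entry (fullOp (clamp M (mix E W V))) z x y‖ₑ ^ s ∂P ≤
      ∑ e ∈ bdry Λ, (N + 1) * k *
        (F V (outer e) + ∑ e' ∈ bdry Λ, (m * F V (outer e') + F V e'.1)) := by
    intro V
    set dx : Site d → (Site d → ℝ) → ℝ≥0∞ := fun w W =>
      ‖entry (decOp Λ (clamp M (mix E W V))) z x w‖ₑ ^ (1 / 2 : ℝ) with hdx
    set fl : Site d → Site d → (Site d → ℝ) → ℝ≥0∞ := fun w w' W =>
      ‖entry (fullOp (clamp M (mix E W V))) z w w'‖ₑ ^ (1 / 2 : ℝ) with hfl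
    set dc : Site d → Site d → (Site d → ℝ) → ℝ≥0∞ := fun w w' W =>
      ‖entry (decOp Λ (clamp M (mix E W V))) z w w'‖ₑ ^ (1 / 2 : ℝ) with hdc
    have mdc : ∀ w w', Measurable (dc w w') := fun w w' =>
      ((measurable_entry_mix hM hKd hz E V w w').enorm).pow_const _
    have mfl : ∀ w w', Measurable (fl w w') := fun w w' =>
      ((measurable_entry_mix hM isSelfAdjoint_neg_laplacian hz E V w w').enorm).pow_const _
    have mdx : ∀ w, Measurable (dx w) := mdc x
    have bdc : ∀ w ∈ E, ∀ w' ∈ E, ∫⁻ W, dc w w' W ∂P ≤ C := fun w hw w' hw' =>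
      hC.2 _ hKd hKdR z hz E V w w' hw hw'
    have bfl : ∀ w ∈ E, ∀ w' ∈ E, ∫⁻ W, fl w w' W ∂P ≤ C := fun w hw w' hw' =>
      hC.2 _ isSelfAdjoint_neg_laplacian isRealOp_neg_laplacian z hz E V w w' hw hw'
    have hΛE : ∀ w ∈ Λ, w ∈ E := fun w hw => subset_enlarge Λ hw
    have hoE : ∀ e ∈ bdry Λ, outer e ∈ E := fun e he => outer_mem_enlarge he
    have hfE : ∀ e ∈ bdry Λ, e.1 ∈ E := fun e he => hΛE _ (fst_mem_of_mem_bdry he)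
    have hgood : ∀ e ∈ bdry Λ, ∀ W ∉ B, dx e.1 W ^ (2 * s) ≤ ε := by
      intro e he W hW
      rw [hdx]
      simp only
      rw [← hhalf]
      exact hε _ (fun h => hW (hBmix W V h)) e he
    have h3 : ∀ e ∈ bdry Λ, ∀ Y Z : (Site d → ℝ) → ℝ≥0∞, Measurable Y → Measurable Z →
        ∫⁻ W, Y W ∂P ≤ C → ∫⁻ W, Z W ∂P ≤ C →
        ∫⁻ W, dx e.1 W ^ (2 * s) * Y W ^ (2 * s) * Z W ^ (2 * s) ∂P ≤ k := by
      intro e he Y Z hY hZ hYC hZC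
      have := lintegral_mul_mul_le_of_compl (mdx e.1) hY hZ hB hC.1 (r := 2 * s) (by linarith)
        (by linarith) (bdc x (hΛE x hx) e.1 (hfE e he)) hYC hZC (hgood e he)
      rwa [show 1 - 3 * (2 * s) = 1 - 6 * s by ring] at this
    have hone : ∫⁻ _ : Site d → ℝ, (1 : ℝ≥0∞) ∂P ≤ C := by simpa using hC.1
    refine (lintegral_mono fun W => enorm_entry_fullOp_rpow_le hs0 hs1' hz Λ
      (clamp M (mix E W V)) hx hy).trans ?_
    rw [lintegral_finsetSum']
    swap
    · intro e _
      have a1 := mdx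
      have a2 := mfl
      have h1 : ∀ w w', Measurable fun W => ‖entry (decOp Λ (clamp M (mix E W V))) z w w'‖ₑ ^ s :=
        fun w w' => ((measurable_entry_mix hM hKd hz E V w w').enorm).pow_const _
      have h2 : ∀ w w', Measurable fun W => ‖entry (fullOp (clamp M (mix E W V))) z w w'‖ₑ ^ s :=
        fun w w' => ((measurable_entry_mix hM isSelfAdjoint_neg_laplacian hz E V w w').enorm).pow_const _
      exact (((h1 _ _).add (Finset.measurable_fun_sum _ fun e' _ =>
        (h1 _ _).mul (h2 _ _))).mul (h1 _ _)).aemeasurable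
    refine Finset.sum_le_sum fun e he => ?_
    -- `none` indexes the leading term of each expansion and `some e'` a boundary summand, whence
    -- the count N + 1. Where fewer than three random factors occur, the missing ones are replaced
    -- by 1.
    set X : Option (Site d × Fin d × Bool) → (Site d → ℝ) → ℝ≥0∞ := fun o W =>
      o.elim (dx e.1 W ^ (2 * s)) fun e' => dx e'.1 W ^ (2 * s) * fl (outer e') e.1 W ^ (2 * s)
      with hX
    set Z : Option (Site d × Fin d × Bool) → (Site d → ℝ) → ℝ≥0∞ := fun o W =>
      o.elim 1 fun e' => dc (outer e) (outer e') W ^ (2 * s) with hZ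
    set G : Option (Site d × Fin d × Bool) → ℝ≥0∞ := fun o =>
      o.elim (F V (outer e)) fun e' => m * F V (outer e') + F V e'.1 with hG
    have hle := lintegral_sum_mul_sum_le (P := P) (Finset.insertNone (bdry Λ))
      (Finset.insertNone (bdry Λ)) (X := X) (Z := Z) G (k := k) (by
        rintro (_ | e') he'
        · exact (mdx _).pow_const _
        · exact ((mdx _).pow_const _).mul ((mfl _ _).pow_const _)) (by
        rintro (_ | e') he'
        · exact measurable_const
        · exact (mdc _ _).pow_const _) (by
        rintro (_ | e') he' (_ | e'') he''
        · have := h3 e he (fun _ => 1) (fun _ => 1) measurable_const measurable_const hone hone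
          simpa [hX, hZ] using this
        · rw [Finset.some_mem_insertNone] at he''
          have := h3 e he (fun _ => 1) _ measurable_const (mdc (outer e) (outer e'')) hone
            (bdc _ (hoE e he) _ (hoE e'' he''))
          simpa [hX, hZ] using this
        · rw [Finset.some_mem_insertNone] at he'
          have := h3 e' he' _ (fun _ => 1) (mfl (outer e') e.1) measurable_const
            (bfl _ (hoE e' he') _ (hfE e he)) hone
          simpa [hX, hZ] using this
        · rw [Finset.some_mem_insertNone] at he' he''
          exact h3 e' he' _ _ (mfl (outer e') e.1) (mdc (outer e) (outer e''))
            (bfl _ (hoE e' he') _ (hfE e he)) (bdc _ (hoE e he) _ (hoE e'' he'')))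
    simp only [Finset.sum_insertNone, Finset.card_insertNone, Nat.cast_add, Nat.cast_one] at hle
    refine le_trans (lintegral_mono fun W => ?_) hle
    simp only [hX, hZ, hG, Option.elim, hdx, hfl, hdc, ← hhalf, one_mul]
    gcongr
    exact enorm_entry_decOp_rpow_le hM hs0 hs1' hz Λ W V (outer_notMem_of_mem_bdry he) y
  refine (lintegral_mono inner).trans ?_
  have hFm : ∀ w, Measurable fun V => F V w := hmeasF
  have hG1 : ∀ e' : Site d × Fin d × Bool, Measurable fun V => m * F V (outer e') + F V e'.1 :=
    fun e' => ((hFm _).const_mul _).add (hFm _)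
  have hG2 : Measurable fun V => ∑ e' ∈ bdry Λ, (m * F V (outer e') + F V e'.1) :=
    Finset.measurable_fun_sum _ fun e' _ => hG1 e'
  have hG3 : ∀ e : Site d × Fin d × Bool, Measurable fun V =>
      F V (outer e) + ∑ e' ∈ bdry Λ, (m * F V (outer e') + F V e'.1) := fun e => (hFm _).add hG2
  rw [lintegral_finsetSum _ fun e _ => (hG3 e).const_mul _]
  have hterm : ∀ e ∈ bdry Λ, ∫⁻ V, (N + 1) * k *
        (F V (outer e) + ∑ e' ∈ bdry Λ, (m * F V (outer e') + F V e'.1)) ∂P ≤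
        (N + 1) * k * ((1 + N * (m + 1)) * τ) := by
    intro e he
    rw [lintegral_const_mul _ (hG3 e), lintegral_add_left (hFm _),
      lintegral_finsetSum _ fun e' _ => hG1 e']
    gcongr
    calc _ ≤ τ + ∑ e' ∈ bdry Λ, (m * τ + τ) := by
          gcongr with e' he'
          · exact hτ _ (outer_mem_enlarge he)
          · rw [lintegral_add_left ((hFm _).const_mul _), lintegral_const_mul _ (hFm _)]
            gcongr
            · exact hτ _ (outer_mem_enlarge he')
            · exact hτ _ (subset_enlarge Λ (fst_mem_of_mem_bdry he'))
      _ = _ := by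
          rw [Finset.sum_const, nsmul_eq_mul]; ring
  refine (Finset.sum_le_sum hterm).trans (le_of_eq ?_)
  rw [Finset.sum_const, nsmul_eq_mul]
  ring

/-! ### Geometry of the box and its boundary -/

theorem mem_box_iff {L : ℝ} {x : Site d} : x ∈ box d L ↔ ∀ i, -⌊L⌋ ≤ x i ∧ x i ≤ ⌊L⌋ := by
  simp only [box, Finset.mem_Icc, Pi.le_def, forall_and]

theorem zero_mem_box {L : ℝ} (hL : 0 ≤ L) : (0 : Site d) ∈ box d L := by
  have := Int.floor_nonneg.2 hL
  rw [mem_box_iff]; intro i; simp [this]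

theorem step_apply_of_ne {j : Fin d × Bool} {k : Fin d} (h : k ≠ j.1) : step j k = 0 :=
  Pi.single_eq_of_ne h _

theorem step_apply_self (j : Fin d × Bool) : step j j.1 = if j.2 then 1 else -1 :=
  Pi.single_eq_same _ _

theorem abs_step_apply_le (j : Fin d × Bool) (k : Fin d) : |step j k| ≤ 1 := by
  by_cases h : k = j.1
  · rw [h, step_apply_self]; split_ifs <;> simp
  · rw [step_apply_of_ne h]; simp

theorem apply_of_mem_bdry_box {L : ℝ} {e : Site d × Fin d × Bool} (he : e ∈ bdry (box d L)) :
    e.1 e.2.1 = if e.2.2 then ⌊L⌋ else -⌊L⌋ := by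
  have h1 := mem_box_iff.1 (fst_mem_of_mem_bdry he)
  have h2 := outer_notMem_of_mem_bdry he
  rw [mem_box_iff] at h2
  obtain ⟨k, hk⟩ := not_forall.1 h2
  have hk' : k = e.2.1 := by
    by_contra hne
    apply hk
    simpa [outer, step_apply_of_ne hne] using h1 k
  subst hk'
  have h3 := h1 e.2.1
  simp only [outer, Pi.add_apply, step_apply_self] at hk
  split_ifs at hk ⊢ <;> omega

theorem abs_apply_of_mem_bdry_box {L : ℝ} (hL : 0 ≤ L) {e : Site d × Fin d × Bool}
    (he : e ∈ bdry (box d L)) : |e.1 e.2.1| = ⌊L⌋ := by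
  have := Int.floor_nonneg.2 hL
  rw [apply_of_mem_bdry_box he]
  split_ifs
  · exact abs_of_nonneg this
  · rw [abs_neg, abs_of_nonneg this]

/-- An edge leaving in one of the 2d directions starts on the corresponding face; the remaining d -
1 coordinates each take 2⌊L⌋ + 1 ≤ 3L values. -/
theorem card_bdry_box_le (d : ℕ) {L : ℝ} (hL : 1 ≤ L) :
    ((bdry (box d L)).card : ℝ) ≤ 2 * d * (3 * L) ^ (d - 1) := by
  classical
  set n := ⌊L⌋ with hn
  have hn1 : 1 ≤ n := Int.le_floor.2 (by exact_mod_cast hL)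
  set S : Fin d × Bool → Finset (Site d) := fun j =>
    Fintype.piFinset fun k => if k = j.1 then {if j.2 then n else -n} else Finset.Icc (-n) n with hS
  have hsub : bdry (box d L) ⊆ Finset.univ.biUnion fun j : Fin d × Bool =>
      (S j).image fun x => (x, j) := by
    intro e he
    rw [Finset.mem_biUnion]
    refine ⟨e.2, Finset.mem_univ _, Finset.mem_image.2 ⟨e.1, ?_, rfl⟩⟩
    rw [hS, Fintype.mem_piFinset]
    intro k
    by_cases hk : k = e.2.1
    · rw [if_pos hk, hk, Finset.mem_singleton]
      exact apply_of_mem_bdry_box he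
    · rw [if_neg hk, Finset.mem_Icc]
      exact mem_box_iff.1 (fst_mem_of_mem_bdry he) k
  have hcard : ∀ j, (S j).card = (2 * n + 1).toNat ^ (d - 1) := by
    intro j
    rw [hS, Fintype.card_piFinset, ← Finset.mul_prod_erase Finset.univ _ (Finset.mem_univ j.1)]
    rw [if_pos rfl, Finset.card_singleton, one_mul]
    rw [Finset.prod_congr rfl (g := fun _ => (2 * n + 1).toNat)]
    · rw [Finset.prod_const, Finset.card_erase_of_mem (Finset.mem_univ _)]
      simp
    · intro k hk
      rw [if_neg (Finset.ne_of_mem_erase hk), Int.card_Icc]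
      congr 1; ring
  have h1 : (bdry (box d L)).card ≤ 2 * d * (2 * n + 1).toNat ^ (d - 1) := by
    refine (Finset.card_le_card hsub).trans (Finset.card_biUnion_le.trans ?_)
    refine (Finset.sum_le_sum fun j _ => Finset.card_image_le).trans ?_
    simp only [hcard, Finset.sum_const, Finset.card_univ, Fintype.card_prod, Fintype.card_fin,
      Fintype.card_bool, smul_eq_mul]
    rw [mul_comm d 2]
  have h2 : (((2 * n + 1).toNat : ℕ) : ℝ) ≤ 3 * L := by
    have h3 : (((2 * n + 1).toNat : ℕ) : ℤ) = 2 * n + 1 := Int.toNat_of_nonneg (by omega)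
    have h4 : (((2 * n + 1).toNat : ℕ) : ℝ) = 2 * n + 1 := by exact_mod_cast h3
    have h5 : (n : ℝ) ≤ L := Int.floor_le L
    rw [h4]; linarith
  calc ((bdry (box d L)).card : ℝ) ≤ ((2 * d * (2 * n + 1).toNat ^ (d - 1) : ℕ) : ℝ) := by
        exact_mod_cast h1
    _ = 2 * d * (((2 * n + 1).toNat : ℕ) : ℝ) ^ (d - 1) := by push_cast; ring
    _ ≤ _ := by gcongr

theorem abs_apply_le_of_mem_enlarge_box {L : ℝ} {w : Site d} (hw : w ∈ enlarge (box d L))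
    (i : Fin d) : |w i| ≤ ⌊L⌋ + 1 := by
  classical
  rcases Finset.mem_union.1 hw with h | h
  · have := mem_box_iff.1 h i
    rw [abs_le]; omega
  · obtain ⟨e, he, rfl⟩ := Finset.mem_image.1 h
    have h1 := mem_box_iff.1 (fst_mem_of_mem_bdry he) i
    have h2 := abs_le.1 (abs_step_apply_le e.2 i)
    rw [outer, Pi.add_apply, abs_le]
    omega

/-! ### The resonance event and decay off it -/

theorem finiteHamiltonian_congr {V W : Site d → ℝ} {Λ : Finset (Site d)}
    (h : ∀ x ∈ Λ, V x = W x) : finiteHamiltonian V Λ = finiteHamiltonian W Λ := by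
  ext x y
  simp only [finiteHamiltonian, Matrix.of_apply, h x x.2]

/-- The potentials for which the finite volume spectrum comes within distance `δ` of `E`. -/
def resonant (M : ℝ) (Λ : Finset (Site d)) (E δ : ℝ) : Set (Site d → ℝ) :=
  {W | Metric.infDist E (spectrum ℝ (finiteHamiltonian (clamp M W) Λ)) ≤ δ}

/-- Resonance depends only on the values in `Λ`, so for the mixed potential it is an event for the
fresh copy `W`, with probability not depending on `V`. -/
theorem mem_of_mix_mem_resonant {M : ℝ} {Λ : Finset (Site d)} {E δ : ℝ} {F : Set (Site d)}
    (hF : ↑Λ ⊆ F) (W V : Site d → ℝ) (h : mix F W V ∈ resonant M Λ E δ) :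
    W ∈ resonant M Λ E δ := by
  have : finiteHamiltonian (clamp M (mix F W V)) Λ = finiteHamiltonian (clamp M W) Λ :=
    finiteHamiltonian_congr fun x hx => by rw [clamp, clamp, mix_of_mem (hF hx)]
  rw [resonant, Set.mem_ofPred_eq, this] at h
  exact h

theorem mem_spectrum_iff_det {n : Type*} [Fintype n] [DecidableEq n] (A : Matrix n n ℝ) (t : ℝ) :
    t ∈ spectrum ℝ A ↔ (t • (1 : Matrix n n ℝ) - A).det = 0 := by
  rw [spectrum.mem_iff, Matrix.isUnit_iff_isUnit_det, isUnit_iff_ne_zero, not_not,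
    Algebra.algebraMap_eq_smul_one]

theorem isClosed_spectrum_matrix {n : Type*} [Fintype n] [DecidableEq n] (A : Matrix n n ℝ) :
    IsClosed (spectrum ℝ A) := by
  have : spectrum ℝ A = {t | (t • (1 : Matrix n n ℝ) - A).det = 0} := by
    ext t; exact mem_spectrum_iff_det A t
  rw [this]
  exact isClosed_eq (by fun_prop) continuous_const

theorem nonempty_spectrum_finiteHamiltonian (V : Site d → ℝ) {Λ : Finset (Site d)}
    (hΛ : Λ.Nonempty) : (spectrum ℝ (finiteHamiltonian V Λ)).Nonempty := by
  have h : (finiteHamiltonian V Λ).IsHermitian := by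
    rw [Matrix.IsHermitian, Matrix.conjTranspose_eq_transpose_of_trivial]
    exact isSymm_finiteHamiltonian V Λ
  obtain ⟨x, hx⟩ := hΛ
  exact ⟨_, h.eigenvalues_mem_spectrum_real ⟨x, hx⟩⟩

theorem continuous_finiteHamiltonian_clamp (M : ℝ) (Λ : Finset (Site d)) :
    Continuous fun W : Site d → ℝ => finiteHamiltonian (clamp M W) Λ := by
  refine continuous_pi fun x => continuous_pi fun y => ?_
  simp only [finiteHamiltonian, Matrix.of_apply]
  split_ifs
  · unfold clamp; fun_prop
  · fun_prop
  · fun_prop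

/-- Resonance means that the characteristic determinant vanishes at some t in the compact interval
[E - δ, E + δ]. Projection along a compact factor maps closed sets to closed sets. Nonemptiness of
`Λ` ensures that the distance to the spectrum is attained. -/
theorem measurableSet_resonant (M : ℝ) {Λ : Finset (Site d)} (hΛ : Λ.Nonempty) (E δ : ℝ) :
    MeasurableSet (resonant M Λ E δ) := by
  refine IsClosed.measurableSet ?_
  set K : Set ℝ := Metric.closedBall E δ
  set S : Set ((Site d → ℝ) × K) :=
    {p | ((p.2 : ℝ) • (1 : Matrix Λ Λ ℝ) - finiteHamiltonian (clamp M p.1) Λ).det = 0} with hS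
  have hSc : IsClosed S := by
    refine isClosed_eq ?_ continuous_const
    exact ((continuous_subtype_val.comp continuous_snd).smul continuous_const |>.sub
      ((continuous_finiteHamiltonian_clamp M Λ).comp continuous_fst)).matrix_det
  have : resonant M Λ E δ = Prod.fst '' S := by
    ext W
    simp only [resonant, Set.mem_ofPred_eq, Set.mem_image]
    constructor
    · intro h
      obtain ⟨t, ht, hd⟩ := (isClosed_spectrum_matrix _).exists_infDist_eq_dist
        (nonempty_spectrum_finiteHamiltonian (clamp M W) hΛ) E
      have htK : t ∈ K := by
        rw [Metric.mem_closedBall, dist_comm, ← hd]; exact h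
      exact ⟨(W, ⟨t, htK⟩), (mem_spectrum_iff_det _ _).1 ht, rfl⟩
    · rintro ⟨⟨W', t⟩, hp, rfl⟩
      refine (Metric.infDist_le_dist_of_mem ((mem_spectrum_iff_det _ _).2 hp)).trans ?_
      rw [dist_comm]
      exact t.2
  rw [this]
  exact isClosedMap_fst_of_compactSpace _ hSc

theorem abs_sub_apply_le_of_neighbors {x y : Site d} (h : Neighbors x y) (i : Fin d) :
    abs (|(x i : ℝ)| - |(y i : ℝ)|) ≤ 1 := by
  obtain ⟨j, rfl⟩ := exists_step_of_neighbors h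
  refine (abs_abs_sub_abs_le_abs_sub _ _).trans ?_
  have := abs_step_apply_le j i
  have h2 : ((((y + step j) i : ℤ) : ℝ) - (y i : ℝ)) = ((step j i : ℤ) : ℝ) := by
    rw [Pi.add_apply]; push_cast; ring
  rw [h2]
  exact_mod_cast this

/-- Moving from `E` to Re z costs half of the gap. The Combes–Thomas weight is a single coordinate
-|x_i|, which suffices because an edge leaves the box through a face where one coordinate is
extremal. -/
theorem norm_entry_decOp_le_of_notMem_resonant (hd : 1 ≤ d) {M : ℝ} (hM : 0 ≤ M)
    (Λ : Finset (Site d)) {E δ : ℝ} (hδ0 : 0 < δ) (hδ1 : δ ≤ 1) {z : ℂ} (hz : z.im ≠ 0)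
    (hzE : |z.re - E| ≤ δ / 2) {V : Site d → ℝ} (hV : V ∉ resonant M Λ E δ)
    {x u : Site d} (hx : x ∈ Λ) (hu : u ∈ Λ) (i : Fin d) :
    ‖entry (decOp Λ (clamp M V)) z x u‖ ≤
      4 / δ * Real.exp (-(δ / (16 * d) * (|(u i : ℝ)| - |(x i : ℝ)|))) := by
  have hspec : ∀ t ∈ spectrum ℝ (finiteHamiltonian (clamp M V) Λ), δ / 2 ≤ |t - z.re| := by
    intro t ht
    have h1 := Metric.infDist_le_dist_of_mem (x := E) ht
    have h2 : δ < Metric.infDist E (spectrum ℝ (finiteHamiltonian (clamp M V) Λ)) := not_le.1 hV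
    rw [Real.dist_eq] at h1
    have h3 := abs_sub_le t z.re E
    rw [abs_sub_comm] at h1
    linarith
  have h := norm_le_of_finiteHamiltonian_solution hd Λ (clamp M V) (half_pos hδ0)
    (by linarith) hspec (fun x => -|(x i : ℝ)|) (by
      intro x y hxy
      have := abs_sub_apply_le_of_neighbors hxy i
      rwa [← abs_neg, neg_sub_neg, neg_sub])
    (fun x => entry (decOp Λ (clamp M V)) z x u) ⟨u, hu⟩
    (fun x => finiteHamiltonian_mulVec_entry Λ (bddAbove_clamp hM V) hz x ⟨u, hu⟩) ⟨x, hx⟩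
  refine h.trans (le_of_eq ?_)
  congr 1
  · field_simp; norm_num
  · congr 1
    simp only
    field_simp; ring

/-! ### Stationarity and iteration to exponential decay -/

theorem mulOp_comp_shift {V : Site d → ℝ} (hV : BddAbove (Set.range fun x => |V x|)) (v : Site d) :
    shift v * mulOp V = mulOp (fun x => V (x + v)) * shift v := by
  have hV' : BddAbove (Set.range fun x => |V (x + v)|) :=
    hV.mono (by rintro _ ⟨x, rfl⟩; exact ⟨x + v, rfl⟩)
  ext ψ x
  simp only [mul_apply_eq_comp, shift_apply, mulOp_apply hV, mulOp_apply hV']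

theorem commute_shift_shift (v w : Site d) : Commute (shift v : L2 d →L[ℂ] L2 d) (shift w) := by
  ext ψ x
  simp only [mul_apply_eq_comp, shift_apply, add_right_comm]

theorem commute_shift_neg_laplacian (v : Site d) : Commute (shift v) (-laplacian d) := by
  refine Commute.neg_right (Commute.sum_right _ _ _ fun i _ => ?_)
  exact ((commute_shift_shift _ _).add_right (commute_shift_shift _ _)).sub_right
    ((Commute.one_right _).smul_right _)

theorem entry_fullOp_translate {V : Site d → ℝ} (hV : BddAbove (Set.range fun x => |V x|)) {z : ℂ}
    (hz : z.im ≠ 0) (x y : Site d) :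
    entry (fullOp V) z x y = entry (fullOp fun w => V (w + x)) z 0 (y - x) := by
  set V' : Site d → ℝ := fun w => V (w + x)
  have h1 : shift x * (fullOp V - z • 1) = (fullOp V' - z • 1) * shift x := by
    rw [mul_sub, sub_mul, fullOp, fullOp, mul_add, add_mul, mulOp_comp_shift hV,
      (commute_shift_neg_laplacian x).eq, mul_smul_comm, smul_mul_assoc, mul_one, one_mul]
  have h2 : shift x * res (fullOp V) z = res (fullOp V') z * shift x := by
    calc shift x * res (fullOp V) z
        = res (fullOp V') z * ((fullOp V' - z • 1) * shift x) * res (fullOp V) z := by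
          rw [← mul_assoc, res_mul (isSelfAdjoint_fullOp V') hz, one_mul]
      _ = _ := by
          rw [← h1, mul_assoc, mul_assoc, mul_res (isSelfAdjoint_fullOp V) hz, mul_one]
  have h3 := congrArg (fun T : L2 d →L[ℂ] L2 d => (T (ket y) : Site d → ℂ) 0) h2
  simp only [mul_apply_eq_comp, shift_apply, shift_ket, zero_add] at h3
  exact h3

theorem lintegral_entry_translate {M : ℝ} (hM : 0 ≤ M) (ν : Measure ℝ) [IsProbabilityMeasure ν]
    (s : ℝ) {z : ℂ} (hz : z.im ≠ 0) (x y : Site d) :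
    ∫⁻ W, ‖entry (fullOp (clamp M W)) z x y‖ₑ ^ s ∂iidLaw d ν =
      ∫⁻ W, ‖entry (fullOp (clamp M W)) z 0 (y - x)‖ₑ ^ s ∂iidLaw d ν := by
  have h1 := Measure.map_infinitePi_infinitePi_of_inj (P := fun _ : Site d => ν)
    (f := fun w => w + x) (add_left_injective x)
  have hm : Measurable fun W : Site d → ℝ => ‖entry (fullOp (clamp M W)) z 0 (y - x)‖ₑ ^ s :=
    ((measurable_entry hM isSelfAdjoint_neg_laplacian hz 0 (y - x)).enorm).pow_const s
  have h2 := lintegral_map (μ := iidLaw d ν) (g := fun (W : Site d → ℝ) w => W (w + x)) hm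
    (by fun_prop)
  rw [h1] at h2
  rw [h2]
  refine lintegral_congr fun W => ?_
  rw [entry_fullOp_translate (bddAbove_clamp hM W) hz]
  rfl

theorem siteDist_le_of_forall_abs_le {x y : Site d} {a : ℤ} (h : ∀ i, |(y - x) i| ≤ a) :
    siteDist x y ≤ d * a := by
  rw [siteDist]
  refine (Finset.sum_le_card_nsmul Finset.univ _ (a : ℝ) fun i _ => ?_).trans (by simp)
  have := h i
  rw [Pi.sub_apply, abs_sub_comm] at this
  exact_mod_cast this

/-- If the finite volume criterion holds with contraction factor `1/2`, the moments of the Green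
function decay exponentially. -/
theorem lintegral_entry_le_exp (hd : 1 ≤ d) {M : ℝ} (hM : 0 ≤ M) (ν : Measure ℝ)
    [IsProbabilityMeasure ν] {s : ℝ} {z : ℂ} (hz : z.im ≠ 0) {L : ℝ} (hL : 0 ≤ L) {C₁ : ℝ≥0}
    (hC₁ : ∀ y : Site d, ∫⁻ W, ‖entry (fullOp (clamp M W)) z 0 y‖ₑ ^ s ∂iidLaw d ν ≤ C₁)
    (hstep : ∀ (τ : ℝ≥0∞) (y : Site d), y ∉ box d L → (∀ w ∈ enlarge (box d L),
      ∫⁻ W, ‖entry (fullOp (clamp M W)) z w y‖ₑ ^ s ∂iidLaw d ν ≤ τ) →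
      ∫⁻ W, ‖entry (fullOp (clamp M W)) z 0 y‖ₑ ^ s ∂iidLaw d ν ≤ ENNReal.ofReal (1 / 2) * τ)
    (x y : Site d) :
    ∫⁻ W, ‖entry (fullOp (clamp M W)) z x y‖ₑ ^ s ∂iidLaw d ν ≤
      ENNReal.ofReal (2 * C₁ * Real.exp (-(Real.log 2 / (d * (⌊L⌋ + 1))) * siteDist x y)) := by
  set n := ⌊L⌋ with hn
  have hn0 : 0 ≤ n := Int.floor_nonneg.2 hL
  -- Points of the enlarged box have coordinates at most n + 1 in modulus, so one contraction
  -- followed by recentring consumes n + 1 of the coordinate `y i`.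
  have hiter : ∀ (k : ℕ) (y : Site d), (∃ i, (k : ℤ) * (n + 1) ≤ |y i|) →
      ∫⁻ W, ‖entry (fullOp (clamp M W)) z 0 y‖ₑ ^ s ∂iidLaw d ν ≤
        ENNReal.ofReal ((1 / 2) ^ k * C₁) := by
    intro k
    induction k with
    | zero => intro y _; simpa using hC₁ y
    | succ k ih =>
      rintro y ⟨i, hi⟩
      push_cast at hi
      have hy : y ∉ box d L := by
        intro hy
        have h1 := mem_box_iff.1 hy i
        have h2 : |y i| ≤ n := abs_le.2 h1
        have h3 : 0 ≤ (k : ℤ) * (n + 1) := by positivity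
        nlinarith
      have := hstep (ENNReal.ofReal ((1 / 2) ^ k * C₁)) y hy fun w hw => by
        rw [lintegral_entry_translate hM ν s hz]
        refine ih _ ⟨i, ?_⟩
        have h1 := abs_apply_le_of_mem_enlarge_box hw i
        have h2 := abs_sub_abs_le_abs_sub (y i) (w i)
        rw [Pi.sub_apply]
        rw [← hn] at h1
        nlinarith
      refine this.trans (le_of_eq ?_)
      rw [← ENNReal.ofReal_mul (by norm_num)]
      congr 1; ring
  rw [lintegral_entry_translate hM ν s hz]
  have : Nonempty (Fin d) := ⟨⟨0, hd⟩⟩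
  obtain ⟨i, hi⟩ := Finite.exists_max fun i => |(y - x) i|
  set a := |(y - x) i| with ha
  have ha0 : 0 ≤ a := abs_nonneg _
  have hnpos : 0 < n + 1 := by omega
  -- The number of available steps. Rounding down loses less than one step, which the factor 2 in `2
  -- * C₁` repays.
  set k := (a / (n + 1)).toNat with hk
  have hkz : (k : ℤ) = a / (n + 1) := Int.toNat_of_nonneg (Int.ediv_nonneg ha0 hnpos.le)
  refine (hiter k (y - x) ⟨i, ?_⟩).trans (ENNReal.ofReal_le_ofReal ?_)
  · rw [hkz]; exact Int.ediv_mul_le _ hnpos.ne'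
  have hlt : a < ((k : ℤ) + 1) * (n + 1) := by
    rw [hkz]; exact Int.lt_ediv_add_one_mul_self a hnpos
  have hltR : (a : ℝ) ≤ (k + 1) * (n + 1) := by exact_mod_cast hlt.le
  have hsd := siteDist_le_of_forall_abs_le hi
  have hdpos : (0 : ℝ) < d := by exact_mod_cast hd
  have hnR : (0 : ℝ) < n + 1 := by exact_mod_cast hnpos
  have hlog : 0 < Real.log 2 := Real.log_pos (by norm_num)
  have h1 : Real.log 2 / (d * (n + 1)) * siteDist x y ≤ Real.log 2 * (k + 1) := by
    rw [div_mul_eq_mul_div, div_le_iff₀ (by positivity)]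
    calc Real.log 2 * siteDist x y ≤ Real.log 2 * (d * ((k + 1) * (n + 1))) := by
          gcongr
          exact hsd.trans (by gcongr)
      _ = _ := by ring
  have h2 : (1 / 2 : ℝ) ^ (k + 1) = Real.exp (-(Real.log 2 * (k + 1))) := by
    rw [Real.exp_neg, Real.exp_mul, Real.exp_log (by norm_num)]
    rw [one_div, inv_pow, ← Nat.cast_succ, Real.rpow_natCast]
  calc (1 / 2 : ℝ) ^ k * C₁ = 2 * C₁ * (1 / 2) ^ (k + 1) := by ring
    _ ≤ 2 * C₁ * Real.exp (-(Real.log 2 / (d * (n + 1))) * siteDist x y) := by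
        rw [h2]
        gcongr
        linarith

/-! ### The contraction factor for large boxes -/

theorem exists_isMomentBound (d : ℕ) {M : ℝ} {ν : Measure ℝ} [IsProbabilityMeasure ν]
    (hν : IsBoundedLaw M ν) : ∃ C : ℝ≥0, IsMomentBound d M ν C := by
  obtain ⟨C, hC⟩ := exists_lintegral_entry_rpow_le (d := d) hν (s := 1 / 2) (by norm_num)
    (by norm_num)
  refine ⟨C + 1, by simp, fun K hK hR z hz F V x y hx hy => ?_⟩
  exact (hC K hK hR z hz F V x y hx hy).trans (by simp)

/-- The contraction factor of the finite volume criterion. -/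
def contraction (d : ℕ) (M s L δ Q C : ℝ) : ℝ :=
  2 * d * (3 * L) ^ (d - 1) * ((2 * d * (3 * L) ^ (d - 1) + 1) *
    (((4 / δ * Real.exp (-(δ / (16 * d) * ⌊L⌋))) ^ s + Q ^ (1 - 6 * s)) * C) *
    (1 + 2 * d * (3 * L) ^ (d - 1) * ((2 * M) ^ s + 1)))

theorem contraction_expr_le_ofReal {N ε Q C m : ℝ} (hN : 0 ≤ N) (hε : 0 ≤ ε) (hQ : 0 ≤ Q)
    (hC : 0 ≤ C) (hm : 0 ≤ m) {N' ε' Q' C' m' : ℝ≥0∞} (hN' : N' ≤ ENNReal.ofReal N)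
    (hε' : ε' ≤ ENNReal.ofReal ε) (hQ' : Q' ≤ ENNReal.ofReal Q) (hC' : C' ≤ ENNReal.ofReal C)
    (hm' : m' ≤ ENNReal.ofReal m) :
    N' * ((N' + 1) * ((ε' + Q') * C') * (1 + N' * (m' + 1))) ≤
      ENNReal.ofReal (N * ((N + 1) * ((ε + Q) * C) * (1 + N * (m + 1)))) := by
  rw [ENNReal.ofReal_mul hN, ENNReal.ofReal_mul (by positivity), ENNReal.ofReal_mul (by positivity),
    ENNReal.ofReal_mul (by positivity), ENNReal.ofReal_add hN zero_le_one,
    ENNReal.ofReal_add hε hQ, ENNReal.ofReal_add zero_le_one (by positivity),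
    ENNReal.ofReal_mul hN, ENNReal.ofReal_add hm zero_le_one, ENNReal.ofReal_one]
  gcongr

/-- The finite volume criterion for the localization of the truncated operators. -/
theorem exists_lintegral_entry_le_exp (hd : 1 ≤ d) {M : ℝ} {ν : Measure ℝ} [IsProbabilityMeasure ν]
    (hν : IsBoundedLaw M ν) {C : ℝ≥0} (hC : IsMomentBound d M ν C) {s : ℝ} (hs0 : 0 < s)
    (hs1 : 6 * s < 1) {L : ℝ} (hL : 1 ≤ L) {E δ Q : ℝ} (hδ0 : 0 < δ) (hδ1 : δ ≤ 1) (hQ0 : 0 ≤ Q)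
    (hQ : iidLaw d ν (resonant M (box d L) E δ) ≤ ENNReal.ofReal Q)
    (hcon : contraction d M s L δ Q C ≤ 1 / 2) :
    ∃ A m : ℝ, 0 < m ∧ ∀ z : ℂ, z.im ≠ 0 → |z.re - E| ≤ δ / 2 → ∀ x y : Site d,
      ∫⁻ W, ‖entry (fullOp (clamp M W)) z x y‖ₑ ^ s ∂iidLaw d ν ≤
        ENNReal.ofReal (A * Real.exp (-m * siteDist x y)) := by
  have hM := hν.nonneg
  have hL0 : 0 ≤ L := by linarith
  have hdpos : (0 : ℝ) < d := by exact_mod_cast hd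
  obtain ⟨C₁, hC₁⟩ := exists_lintegral_entry_rpow_le (d := d) hν hs0 (by linarith)
  have hfl : (0 : ℝ) ≤ ⌊L⌋ := by exact_mod_cast Int.floor_nonneg.2 hL0
  refine ⟨2 * C₁, Real.log 2 / (d * (⌊L⌋ + 1)), ?_, fun z hz hzE x y => ?_⟩
  · have := Real.log_pos (show (1 : ℝ) < 2 by norm_num)
    positivity
  refine lintegral_entry_le_exp hd hM ν hz hL0 (fun y => ?_) (fun τ y hy hτ => ?_) x y
  · have := hC₁ _ isSelfAdjoint_neg_laplacian isRealOp_neg_laplacian z hz Set.univ 0 0 y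
      (Set.mem_univ _) (Set.mem_univ _)
    simpa only [mix_univ] using this
  have h0 := zero_mem_box (d := d) hL0
  refine (lintegral_entry_fullOp_le (ε := ENNReal.ofReal
    ((4 / δ * Real.exp (-(δ / (16 * d) * ⌊L⌋))) ^ s)) hM hC hs0 hs1 hz (box d L) h0 hy
    (measurableSet_resonant M ⟨0, h0⟩ E δ)
    (fun W V => mem_of_mix_mem_resonant (by exact_mod_cast subset_enlarge _) W V)
    (fun V hV e he => ?_) hτ).trans ?_
  · have h1 := norm_entry_decOp_le_of_notMem_resonant hd hM (box d L) hδ0 hδ1 hz hzE hV h0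
      (fst_mem_of_mem_bdry he) e.2.1
    have h2 : |((e.1 e.2.1 : ℤ) : ℝ)| = ⌊L⌋ := by exact_mod_cast abs_apply_of_mem_bdry_box hL0 he
    rw [h2, Pi.zero_apply, Int.cast_zero, abs_zero, sub_zero] at h1
    rw [← ENNReal.ofReal_rpow_of_nonneg (by positivity) hs0.le, ← ofReal_norm]
    gcongr
  · gcongr
    refine le_trans ?_ (ENNReal.ofReal_le_ofReal hcon)
    have hN : ((bdry (box d L)).card : ℝ≥0∞) ≤ ENNReal.ofReal (2 * d * (3 * L) ^ (d - 1)) := by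
      rw [← ENNReal.ofReal_natCast]
      exact ENNReal.ofReal_le_ofReal (card_bdry_box_le d hL)
    have hQ' : iidLaw d ν (resonant M (box d L) E δ) ^ (1 - 6 * s) ≤
        ENNReal.ofReal (Q ^ (1 - 6 * s)) := by
      rw [← ENNReal.ofReal_rpow_of_nonneg hQ0 (by linarith)]
      exact ENNReal.rpow_le_rpow hQ (by linarith)
    have hm : ENNReal.ofReal (2 * M) ^ s = ENNReal.ofReal ((2 * M) ^ s) :=
      ENNReal.ofReal_rpow_of_nonneg (by positivity) hs0.le
    have hC' : (C : ℝ≥0∞) = ENNReal.ofReal C := ENNReal.ofReal_coe_nnreal.symm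
    exact contraction_expr_le_ofReal (by positivity) (by positivity) (by positivity)
      C.coe_nonneg (by positivity) hN le_rfl hQ' hC'.le hm.le

theorem tendsto_rpow_mul_exp_neg_rpow (p : ℝ) {b c : ℝ} (hb : 0 < b) (hc : 0 < c) :
    Tendsto (fun L : ℝ => L ^ p * Real.exp (-b * L ^ c)) atTop (𝓝 0) := by
  have h := (tendsto_rpow_mul_exp_neg_mul_atTop_nhds_zero (p / c) b hb).comp
    (tendsto_rpow_atTop hc)
  refine h.congr' ?_
  filter_upwards [eventually_ge_atTop 0] with L hL
  simp only [Function.comp]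
  rw [← Real.rpow_mul hL, mul_div_cancel₀ _ hc.ne']

/-- The three boundary sums contribute L^{3(d-1)}. The nonresonant part carries exp(-cL^{1-β}),
which beats every power, and the resonant part carries L^{-ξ(1-6s)}, which wins by `hξ`. -/
theorem eventually_contraction_le (hd : 1 ≤ d) {M C : ℝ} (hM : 0 ≤ M) (hC : 0 ≤ C) {s β ξ : ℝ}
    (hs0 : 0 < s) (hβ1 : β < 1) (hξ : 3 * ((d : ℝ) - 1) < ξ * (1 - 6 * s)) :
    ∀ᶠ L : ℝ in atTop, contraction d M s L (L ^ (-β)) (L ^ (-ξ)) C ≤ 1 / 2 := by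
  have hdpos : (0 : ℝ) < d := by exact_mod_cast hd
  set a : ℝ := 2 * d * 3 ^ (d - 1) with ha
  set m : ℝ := (2 * M) ^ s + 1 with hm
  have ha0 : 0 ≤ a := by positivity
  have hm0 : 0 ≤ m := by positivity
  set q : ℝ := 3 * ((d : ℝ) - 1) with hq
  have h1 : Tendsto (fun L : ℝ => a * (a + 1) * (1 + a * m) * C *
      (4 ^ s * (L ^ (q + β * s) * Real.exp (-(s / (32 * d)) * L ^ (1 - β))) +
        L ^ (-(ξ * (1 - 6 * s) - q)))) atTop (𝓝 0) := by
    have h2 := tendsto_rpow_mul_exp_neg_rpow (q + β * s) (b := s / (32 * d)) (c := 1 - β)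
      (by positivity) (by linarith)
    have h3 := tendsto_rpow_neg_atTop (y := ξ * (1 - 6 * s) - q) (by linarith)
    have := ((h2.const_mul (4 ^ s)).add h3).const_mul (a * (a + 1) * (1 + a * m) * C)
    simpa using this
  filter_upwards [h1.eventually (ge_mem_nhds (show (0 : ℝ) < 1 / 2 by norm_num)),
    eventually_ge_atTop 1] with L hLs hL
  refine le_trans ?_ hLs
  have hL0 : 0 < L := by linarith
  set l : ℝ := L ^ (d - 1) with hl
  have hl1 : 1 ≤ l := one_le_pow₀ hL
  have hN : 2 * (d : ℝ) * (3 * L) ^ (d - 1) = a * l := by rw [mul_pow, ha, hl]; ring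
  have hl3 : l ^ 3 = L ^ q := by
    rw [hl, ← pow_mul, ← Real.rpow_natCast]
    congr 1
    rw [hq]; push_cast [Nat.cast_sub hd]; ring
  have hfl : L / 2 ≤ ⌊L⌋ := by
    have h2 := Int.sub_one_lt_floor L
    have h3 : (1 : ℝ) ≤ ⌊L⌋ := by exact_mod_cast Int.le_floor.2 (by exact_mod_cast hL)
    linarith
  have he : (4 / L ^ (-β) * Real.exp (-(L ^ (-β) / (16 * d) * ⌊L⌋))) ^ s ≤
      4 ^ s * (L ^ (β * s) * Real.exp (-(s / (32 * d)) * L ^ (1 - β))) := by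
    have h2 : 4 / L ^ (-β) * Real.exp (-(L ^ (-β) / (16 * d) * ⌊L⌋)) ≤
        4 * L ^ β * Real.exp (-(1 / (32 * d)) * L ^ (1 - β)) := by
      rw [Real.rpow_neg hL0.le, div_inv_eq_mul]
      gcongr
      rw [← Real.rpow_neg hL0.le, neg_mul, neg_le_neg_iff]
      calc 1 / (32 * (d : ℝ)) * L ^ (1 - β) = L ^ (-β) / (16 * d) * (L / 2) := by
            rw [sub_eq_add_neg, Real.rpow_add hL0, Real.rpow_one]; field_simp; norm_num
        _ ≤ _ := by gcongr
    refine (Real.rpow_le_rpow (by positivity) h2 hs0.le).trans (le_of_eq ?_)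
    rw [Real.mul_rpow (by positivity) (by positivity), Real.mul_rpow (by norm_num) (by positivity),
      ← Real.rpow_mul hL0.le, ← Real.exp_mul]
    rw [mul_assoc]
    congr 3
    ring
  have hQ : (L ^ (-ξ)) ^ (1 - 6 * s) = L ^ (-(ξ * (1 - 6 * s))) := by
    rw [← Real.rpow_mul hL0.le]; congr 1; ring
  set ε := (4 / L ^ (-β) * Real.exp (-(L ^ (-β) / (16 * d) * ⌊L⌋))) ^ s with hε
  have hε0 : 0 ≤ ε := by positivity
  set Q := (L ^ (-ξ)) ^ (1 - 6 * s) with hQdef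
  have hQ0 : 0 ≤ Q := by positivity
  have hsum : L ^ q * (ε + Q) ≤
      4 ^ s * (L ^ (q + β * s) * Real.exp (-(s / (32 * d)) * L ^ (1 - β))) +
        L ^ (-(ξ * (1 - 6 * s) - q)) := by
    rw [hQ, mul_add]
    refine add_le_add ?_ (le_of_eq ?_)
    · calc L ^ q * ε ≤ L ^ q * (4 ^ s * (L ^ (β * s) *
            Real.exp (-(s / (32 * d)) * L ^ (1 - β)))) := by gcongr
        _ = _ := by rw [Real.rpow_add hL0]; ring
    · rw [← Real.rpow_add hL0]; congr 1; ring
  calc contraction d M s L (L ^ (-β)) (L ^ (-ξ)) C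
      = a * l * ((a * l + 1) * ((ε + Q) * C) * (1 + a * l * m)) := by
        rw [contraction, hN]
    _ ≤ a * l * (((a + 1) * l) * ((ε + Q) * C) * ((1 + a * m) * l)) := by
        gcongr
        · linarith
        · nlinarith [mul_nonneg ha0 hm0]
    _ = a * (a + 1) * (1 + a * m) * C * (l ^ 3 * (ε + Q)) := by ring
    _ ≤ _ := by rw [hl3]; gcongr

/-! ### Location of the spectrum and passage to the given random potential -/

/-- Gershgorin: diagonal entries are at most 2d + M in modulus, and off-diagonal row sums at most
2d. -/
theorem abs_le_of_mem_spectrum_finiteHamiltonian {V : Site d → ℝ} {M : ℝ} (hV : ∀ x, |V x| ≤ M)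
    (Λ : Finset (Site d)) {t : ℝ} (ht : t ∈ spectrum ℝ (finiteHamiltonian V Λ)) :
    |t| ≤ 4 * d + M := by
  by_contra! hlt
  rw [mem_spectrum_iff_det] at ht
  refine det_ne_zero_of_sum_row_lt_diag (A := t • (1 : Matrix Λ Λ ℝ) - finiteHamiltonian V Λ)
    (fun k => ?_) ht
  have hdiag : 2 * (d : ℝ) < ‖(t • (1 : Matrix Λ Λ ℝ) - finiteHamiltonian V Λ) k k‖ := by
    simp only [finiteHamiltonian, Matrix.sub_apply, Matrix.smul_apply, Matrix.one_apply_eq,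
      Matrix.of_apply, if_true, smul_eq_mul, mul_one, Real.norm_eq_abs]
    have h1 := abs_sub_abs_le_abs_sub t (2 * (d : ℝ) + V k)
    have h2 := abs_add_le (2 * (d : ℝ)) (V k)
    rw [abs_of_nonneg (by positivity : (0 : ℝ) ≤ 2 * d)] at h2
    linarith [hV k]
  refine lt_of_le_of_lt ?_ hdiag
  calc _ ≤ ∑ j ∈ Finset.univ.erase k,
        (if Neighbors (k : Site d) (j : Site d) then (1 : ℝ) else 0) := by
        refine Finset.sum_le_sum fun j hj => ?_
        have hkj : k ≠ j := (Finset.ne_of_mem_erase hj).symm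
        simp only [finiteHamiltonian, Matrix.sub_apply, Matrix.smul_apply,
          Matrix.one_apply_ne hkj, Matrix.of_apply, if_neg hkj, smul_zero, zero_sub, norm_neg]
        split_ifs <;> simp
    _ ≤ ∑ j : Λ, (if Neighbors (k : Site d) (j : Site d) then (1 : ℝ) else 0) :=
        Finset.sum_le_sum_of_subset_of_nonneg (Finset.erase_subset _ _) fun j _ _ => by
          split_ifs <;> norm_num
    _ ≤ 2 * d := by
        rw [Finset.sum_boole]
        exact_mod_cast card_neighbors_le Λ k

theorem IsRegular.exists_law {Ω : Type*} [MeasurableSpace Ω] {μ : Measure Ω}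
    [IsProbabilityMeasure μ] {V : Site d → Ω → ℝ} (hV : IsRegular μ V) :
    ∃ (M : ℝ) (ν : Measure ℝ) (_ : IsProbabilityMeasure ν), IsBoundedLaw M ν ∧
      (∀ x, μ.map (V x) = ν) ∧ μ.map (fun ω x => V x ω) = iidLaw d ν := by
  obtain ⟨ρ, hρm, ⟨D, hD⟩, hsupp, hmap⟩ := hV.density
  set ν : Measure ℝ := volume.withDensity fun v => (ρ v : ℝ≥0∞) with hν
  have hprob : IsProbabilityMeasure ν := by
    rw [← hmap 0]
    exact Measure.isProbabilityMeasure_map (hV.measurable 0).aemeasurable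
  obtain ⟨R, hR⟩ := hsupp.isCompact.isBounded.subset_closedBall (0 : ℝ)
  refine ⟨max R 0, ν, hprob, ⟨le_max_right _ _, ?_, D, ?_⟩, hmap, ?_⟩
  · rw [hν, ae_withDensity_iff (by fun_prop)]
    refine Eventually.of_forall fun t ht => ?_
    have h1 : t ∈ tsupport ρ := subset_tsupport ρ (by
      intro h0; apply ht; rw [h0]; rfl)
    have h2 := hR h1
    rw [mem_closedBall_zero_iff, Real.norm_eq_abs] at h2
    exact h2.trans (le_max_left _ _)
  · have h1 : ν ≤ volume.withDensity fun _ => (D : ℝ≥0∞) :=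
      withDensity_mono (Eventually.of_forall fun v => ENNReal.coe_le_coe.2 (hD v))
    rw [withDensity_const] at h1
    exact h1
  · exact (hV.indep.hasLaw_infinitePi
      (fun x => ⟨(hV.measurable x).aemeasurable, hmap x⟩)
      (measurable_pi_iff.2 hV.measurable).aemeasurable).map_eq

theorem IsRegular.ae_abs_le {Ω : Type*} [MeasurableSpace Ω] {μ : Measure Ω}
    {V : Site d → Ω → ℝ} (hV : IsRegular μ V) {M : ℝ} {ν : Measure ℝ} (hν : IsBoundedLaw M ν)
    (hmap : ∀ x, μ.map (V x) = ν) : ∀ᵐ ω ∂μ, ∀ x, |V x ω| ≤ M := by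
  rw [ae_all_iff]
  intro x
  have h := hν.ae_abs_le
  rw [← hmap x] at h
  exact ae_of_ae_map (hV.measurable x).aemeasurable h

theorem clamp_eq_self {M : ℝ} {W : Site d → ℝ} (h : ∀ x, |W x| ≤ M) : clamp M W = W :=
  funext fun x => clamp_of_abs_le (h x)

/-- Almost surely all site values lie in [-M, M], so the truncation is inactive and the moments
agree. -/
theorem fractionalMomentLocalization_of_truncated {Ω : Type*} [MeasurableSpace Ω] {μ : Measure Ω}
    {V : Site d → Ω → ℝ} (hV : IsRegular μ V) {M : ℝ} {ν : Measure ℝ}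
    [IsProbabilityMeasure ν] (hν : IsBoundedLaw M ν) (hmap : ∀ x, μ.map (V x) = ν)
    (hlaw : μ.map (fun ω x => V x ω) = iidLaw d ν) {s : ℝ} (hs0 : 0 ≤ s) {E δ A m : ℝ} (hm : 0 < m)
    (h : ∀ z : ℂ, z.im ≠ 0 → |z.re - E| ≤ δ → ∀ x y : Site d,
      ∫⁻ W, ‖entry (fullOp (clamp M W)) z x y‖ₑ ^ s ∂iidLaw d ν ≤
        ENNReal.ofReal (A * Real.exp (-m * siteDist x y))) :
    FractionalMomentLocalization μ V s (E - δ) (E + δ) := by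
  refine ⟨A, m, hm, fun E' hE' η hη x y => ?_⟩
  set z : ℂ := E' + η * Complex.I with hz
  have hre : z.re = E' := by simp [hz]
  have him : z.im = η := by simp [hz]
  have hz0 : z.im ≠ 0 := by rwa [him]
  refine le_trans (le_of_eq ?_) (h z hz0 (by
    rw [hre, abs_le]; constructor <;> linarith [hE'.1, hE'.2]) x y)
  rw [← hlaw, lintegral_map
    (((measurable_entry hν.nonneg isSelfAdjoint_neg_laplacian hz0 x y).enorm).pow_const s)
    (measurable_pi_iff.2 hV.measurable)]
  refine lintegral_congr_ae ?_
  filter_upwards [hV.ae_abs_le hν hmap] with ω hω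
  rw [clamp_eq_self hω, green_eq_entry, ← ofReal_norm,
    ENNReal.ofReal_rpow_of_nonneg (norm_nonneg _) hs0]

theorem IsRegular.measure_resonant_eq {Ω : Type*} [MeasurableSpace Ω] {μ : Measure Ω}
    {V : Site d → Ω → ℝ} (hV : IsRegular μ V) {M : ℝ} {ν : Measure ℝ}
    [IsProbabilityMeasure ν] (hν : IsBoundedLaw M ν) (hmap : ∀ x, μ.map (V x) = ν)
    (hlaw : μ.map (fun ω x => V x ω) = iidLaw d ν) {Λ : Finset (Site d)} (hΛ : Λ.Nonempty)
    (E δ : ℝ) : iidLaw d ν (resonant M Λ E δ) =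
      μ {ω | Metric.infDist E (spectrum ℝ (finiteHamiltonian (fun u => V u ω) Λ)) ≤ δ} := by
  rw [← hlaw, Measure.map_apply (measurable_pi_iff.2 hV.measurable)
    (measurableSet_resonant M hΛ E δ)]
  refine measure_congr ?_
  filter_upwards [hV.ae_abs_le hν hmap] with ω hω
  change (Metric.infDist E (spectrum ℝ (finiteHamiltonian (clamp M fun x => V x ω) Λ)) ≤ δ) = _
  rw [clamp_eq_self hω]
  rfl

theorem abs_sub_le_infDist_spectrum {V : Site d → ℝ} {M : ℝ} (hV : ∀ x, |V x| ≤ M)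
    {Λ : Finset (Site d)} (hΛ : Λ.Nonempty) (E : ℝ) :
    abs (Metric.infDist E (spectrum ℝ (finiteHamiltonian V Λ)) - |E|) ≤ 4 * d + M := by
  obtain ⟨t, ht, hdist⟩ := (isClosed_spectrum_matrix _).exists_infDist_eq_dist
    (nonempty_spectrum_finiteHamiltonian V hΛ) E
  have h1 := abs_le_of_mem_spectrum_finiteHamiltonian hV Λ ht
  rw [hdist, Real.dist_eq]
  refine (abs_abs_sub_abs_le_abs_sub _ _).trans ?_
  rwa [sub_sub_cancel_left, abs_neg]

end RandomSchrodinger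

end

/-! ### The choice of s, δ_L and P_L -/

theorem theorem6 {d : ℕ} (hd : 1 ≤ d) {Ω : Type*} [MeasurableSpace Ω] (μ : Measure Ω)
    [IsProbabilityMeasure μ] (V : RandomSchrodinger.Site d → Ω → ℝ)
    (hV : RandomSchrodinger.IsRegular μ V)
    (β ξ : ℝ) (hβ : β ∈ Set.Ioo (0 : ℝ) 1) (hξ : 3 * ((d : ℝ) - 1) < ξ) :
    ∃ s ∈ Set.Ioo (0 : ℝ) 1, ∃ δ P : ℝ → ℝ,
      (∀ L : ℝ, 0 < L → 0 < δ L ∧ 0 < P L ∧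
        ∀ E : ℝ,
          μ.real {ω | Metric.infDist E (spectrum ℝ (RandomSchrodinger.finiteHamiltonian
              (fun u => V u ω) (RandomSchrodinger.box d L))) ≤ δ L} < P L →
          ∃ a b : ℝ, E ∈ Set.Ioo a b ∧
            RandomSchrodinger.FractionalMomentLocalization μ V s a b) ∧
      0 < liminf (fun L : ℝ => ((L ^ β * δ L : ℝ) : EReal)) atTop ∧
      limsup (fun L : ℝ => ((L ^ β * δ L : ℝ) : EReal)) atTop < ⊤ ∧
      0 < liminf (fun L : ℝ => ((L ^ ξ * P L : ℝ) : EReal)) atTop := by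
  open RandomSchrodinger in
  obtain ⟨M, ν, hprob, hν, hmap, hlaw⟩ := hV.exists_law
  obtain ⟨C, hC⟩ := exists_isMomentBound d hν
  have hd1 : (1 : ℝ) ≤ d := by exact_mod_cast hd
  have hξ0 : 0 < ξ := by linarith
  -- This puts ξ(1 - 6s) at the midpoint of ξ and 3(d-1), hence above the threshold.
  set s : ℝ := (ξ - 3 * ((d : ℝ) - 1)) / (12 * ξ) with hs
  have hs0 : 0 < s := div_pos (by linarith) (by linarith)
  have hsξ : ξ * (1 - 6 * s) = (ξ + 3 * ((d : ℝ) - 1)) / 2 := by rw [hs]; field_simp; ring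
  have hs1 : 6 * s < 1 := by nlinarith
  obtain ⟨L₁, hL₁⟩ := eventually_atTop.1 (eventually_contraction_le hd hν.nonneg C.coe_nonneg
    (β := β) (ξ := ξ) hs0 hβ.2 (by rw [hsξ]; linarith))
  set L₀ := max L₁ 1 with hL₀
  have large : ∀ L, L₀ ≤ L → ∀ E : ℝ,
      μ.real {ω | Metric.infDist E (spectrum ℝ (finiteHamiltonian
        (fun u => V u ω) (box d L))) ≤ L ^ (-β)} < L ^ (-ξ) →
      ∃ a b : ℝ, E ∈ Set.Ioo a b ∧ FractionalMomentLocalization μ V s a b := by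
    intro L hL E hE
    have hL1 : 1 ≤ L := (le_max_right _ _).trans hL
    have hLpos : 0 < L := by linarith
    have hδ0 : 0 < L ^ (-β) := Real.rpow_pos_of_pos hLpos _
    obtain ⟨A, m, hm, h⟩ := exists_lintegral_entry_le_exp hd hν hC hs0 hs1 hL1 (E := E) hδ0
      (Real.rpow_le_one_of_one_le_of_nonpos hL1 (by linarith [hβ.1]))
      (Real.rpow_nonneg hLpos.le (-ξ)) (by
        rw [hV.measure_resonant_eq hν hmap hlaw ⟨0, zero_mem_box hLpos.le⟩]
        rw [measureReal_def] at hE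
        rw [← ENNReal.ofReal_toReal (measure_ne_top μ _)]
        exact ENNReal.ofReal_le_ofReal hE.le) (hL₁ L ((le_max_left _ _).trans hL))
    exact ⟨_, _, ⟨by linarith, by linarith⟩,
      fractionalMomentLocalization_of_truncated hV hν hmap hlaw hs0.le hm h⟩
  have hR0 : (0 : ℝ) ≤ 4 * d + M := by linarith [hν.nonneg]
  -- Such an energy is at distance more than 1 ≥ L₀^{-β} from the spectrum almost surely, so the
  -- criterion at the scale `L₀` applies with resonance probability zero.
  have hfar : ∀ E : ℝ, 4 * d + M + 1 < |E| →
      ∃ a b : ℝ, E ∈ Set.Ioo a b ∧ FractionalMomentLocalization μ V s a b := by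
    intro E hE
    have hL₀1 : 1 ≤ L₀ := le_max_right _ _
    have hL₀0 : 0 < L₀ := by linarith
    refine large L₀ le_rfl E ?_
    have hzero : μ {ω | Metric.infDist E (spectrum ℝ (finiteHamiltonian
        (fun u => V u ω) (box d L₀))) ≤ L₀ ^ (-β)} = 0 := by
      rw [← compl_compl {ω | _}, ← mem_ae_iff]
      filter_upwards [hV.ae_abs_le hν hmap] with ω hω
      have h1 := abs_le.1 (abs_sub_le_infDist_spectrum hω
        (Λ := box d L₀) ⟨0, zero_mem_box hL₀0.le⟩ E)
      have h2 : L₀ ^ (-β) ≤ 1 :=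
        Real.rpow_le_one_of_one_le_of_nonpos hL₀1 (by linarith [hβ.1])
      simp only [Set.mem_compl_iff, Set.mem_ofPred_eq, not_le]
      linarith [h1.1]
    rw [measureReal_def, hzero]
    exact Real.rpow_pos_of_pos hL₀0 _
  -- Below `L₀`, every E with |E| ≤ 4d + M + 1 lies almost surely within 2(4d + M) + 1 of the
  -- spectrum. A probability less than `1` therefore leaves only the energies covered by `hfar`.
  refine ⟨s, ⟨hs0, by linarith⟩, fun L => if L₀ ≤ L then L ^ (-β) else 2 * (4 * d + M) + 1,
    fun L => if L₀ ≤ L then L ^ (-ξ) else 1, fun L hLpos => ?_, ?_, ?_, ?_⟩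
  · by_cases hL : L₀ ≤ L
    · simp only [if_pos hL]
      exact ⟨Real.rpow_pos_of_pos hLpos _, Real.rpow_pos_of_pos hLpos _, large L hL⟩
    · simp only [if_neg hL]
      refine ⟨by linarith, one_pos, fun E hE => hfar E ?_⟩
      by_contra! hle
      refine hE.ne ?_
      rw [measureReal_def, measure_congr (t := Set.univ), measure_univ, ENNReal.toReal_one]
      refine eventuallyEq_univ.2 ?_
      filter_upwards [hV.ae_abs_le hν hmap] with ω hω
      have h1 := abs_le.1 (abs_sub_le_infDist_spectrum hω
        (Λ := box d L) ⟨0, zero_mem_box hLpos.le⟩ E)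
      change Metric.infDist _ _ ≤ _
      linarith [h1.2]
  · have h : (fun L : ℝ => ((L ^ β * (if L₀ ≤ L then L ^ (-β) else 2 * (4 * d + M) + 1) : ℝ) :
        EReal)) =ᶠ[atTop] fun _ => 1 := by
      filter_upwards [eventually_ge_atTop L₀, eventually_gt_atTop 0] with L hL hL0
      rw [if_pos hL, ← Real.rpow_add hL0]; simp
    rw [liminf_congr h, liminf_const]
    exact zero_lt_one
  · have h : (fun L : ℝ => ((L ^ β * (if L₀ ≤ L then L ^ (-β) else 2 * (4 * d + M) + 1) : ℝ) :
        EReal)) =ᶠ[atTop] fun _ => 1 := by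
      filter_upwards [eventually_ge_atTop L₀, eventually_gt_atTop 0] with L hL hL0
      rw [if_pos hL, ← Real.rpow_add hL0]; simp
    rw [limsup_congr h, limsup_const]
    exact EReal.coe_lt_top 1
  · have h : (fun L : ℝ => ((L ^ ξ * (if L₀ ≤ L then L ^ (-ξ) else 1) : ℝ) : EReal))
        =ᶠ[atTop] fun _ => 1 := by
      filter_upwards [eventually_ge_atTop L₀, eventually_gt_atTop 0] with L hL hL0
      rw [if_pos hL, ← Real.rpow_add hL0]; simp
    rw [liminf_congr h, liminf_const]
    exact zero_lt_one
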